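/- **Setting.** Consider the directed graph on $\mathbb N=\{1,2,\dots\}$ in which, for every $i$, there is one edge from $i$ to $2i$, two edges from $i$ to $2i-1$, and (if $i\ge2$) one edge from $i$ to $2i-2$. Every edge from $i$ to $j$ carries a weight $r_{i,j}>0$ (both edges from $i$ to $2i-1$ have the same weight). To an edge $e$ from $i$ to $j$ associate $\phi_e(x)=\frac{j}{2i}x+s_e$, where $s_e=0$ for the edge to $2i$ and the first edge to $2i-1$, and $s_e=\frac1{2i}$ for the second edge to $2i-1$ and the edge to $2i-2$. For a path $\sigma=e_1\cdots e_n$ starting at $i$ let $\phi_\sigma=\phi_{e_1}\circ\cdots\circ\phi_{e_n}$ and $\delta_\sigma=r_{e_1}\cdots r_{e_n}$ (for $n=0$: $\phi_\sigma=\mathrm{id}$, $\delta_\sigma=1$). Let $E_i^{(n)}$ be the set of paths of length $n\ge0$ starting at $i$, let $V_i^{(n)}=\bigcup_{\sigma\in E_i^{(n)}}\{\phi_\sigma(0),\phi_\sigma(1)\}$, and let $W_i^{(n)}$ be the set of pairs (wires) $\{\phi_\sigma(0),\phi_\sigma(1)\}$, $\sigma\in E_i^{(n)}$; each wire $\{x,y\}$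 comes from exactly one path $\sigma_{x,y}^{(n)}$. Put $\overline V_i^*=[0,\frac1i]\cup[1-\frac1i,1]$. For $x\in V_i^{(n)}$ let $U_1^{(n)}(x)=[x-2^{-n-1},x+2^{-n-1})\cap[0,1]$ and, for $i>1$, $U_i^{(n)}(x)=[x,x+\frac1{2^ni})$ if $x<\frac1i$ and $U_i^{(n)}(x)=(x-\frac1{2^ni},x]$ if $x>1-\frac1i$; let $\mu_i^{(n)}(x)=|U_i^{(n)}(x)|$ be its length. Define $j_i^{(n)}(x,y)=\big(\delta_{\sigma_{x,y}^{(n)}}\mu_i^{(n)}(x)\mu_i^{(n)}(y)\big)^{-1}$ if $\{x,y\}\in W_i^{(n)}$ and $j_i^{(n)}(x,y)=0$ otherwise, and for $u:V_i^{(n)}\to\mathbb R$ $$\mathcal E_i^{(n)}(u)=\sum_{x,y\in V_i^{(n)}}(u(x)-u(y))^2\,j_i^{(n)}(x,y)\,\mu_i^{(n)}(x)\mu_i^{(n)}(y).$$ Let $\operatorname{Ext}_i^{(n)}u$ be the function equal to $u(\bar x)$ on $U_i^{(n)}(\bar x)$ for each $\bar x\in V_i^{(n)}$, and let $\operatorname{Avg}_i^{(n)}u(\bar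 x)$ be the mean of $u\in L^2(\overline V_i^*,dx)$ over $U_i^{(n)}(\bar x)$. **Theorem.** Let $i\in\mathbb N$ and $s\in(0,1)$, and assume that there are $\lambda_i,\Lambda_i>0$ such that for all $n\ge0$ and all $\{x,y\}\in W_i^{(n)}$ $$0<j_i^{(n)}(x,y)\le\Lambda_i|x-y|^{-(1+2s)}\quad\text{and}\quad\lambda_i|x-y|^{-(1+2s)}\le j_i^{(n)}(x,y).$$ Assume also that the limit energy is well defined on regular functions, i.e. that $\lim_{n\to\infty}\mathcal E_i^{(n)}(f|_{V_i^{(n)}})$ exists for every Lipschitz function $f$ on $\overline V_i^*$. Then: 1. For every $u\in L^2(\overline V_i^*,dx)$ the limit $\mathcal E_i^{(\infty)}(u):=\lim_{n\to\infty}\mathcal E_i^{(n)}(\operatorname{Avg}_i^{(n)}u)$ exists in $[0,\infty]$; set $\mathcal F_i^{(\infty)}=\{u\in L^2(\overline V_i^*,dx):\mathcal E_i^{(\infty)}(u)<\infty\}$. 2. $\mathcal E_i^{(\infty)}(f)=\lim_{n\to\infty}\mathcal E_i^{(n)}(f|_{V_i^{(n)}})<\infty$ for every $f$ that is Lipschitz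 on $[0,1]$ if $i=1$, $\frac12$-Hölder on $[0,1]$ if $i=2$, continuous on $\overline V_i^*$ if $i>2$. 3. The forms $(\mathcal E_i^{(n)},\ell(V_i^{(n)}))$ $\Gamma$-converge to $(\mathcal E_i^{(\infty)},\mathcal F_i^{(\infty)})$ in the generalized sense: (a) if $u_n:V_i^{(n)}\to\mathbb R$ and $u\in L^2(\overline V_i^*,dx)$ are such that $\operatorname{Ext}_i^{(n)}u_n\to u$ strongly in $L^2(\overline V_i^*,dx)$, then $\liminf_{n\to\infty}\mathcal E_i^{(n)}(u_n)\ge\mathcal E_i^{(\infty)}(u)$; (b) for every $u\in L^2(\overline V_i^*,dx)$ there are $u_n:V_i^{(n)}\to\mathbb R$ such that $\operatorname{Ext}_i^{(n)}u_n\to u$ strongly in $L^2(\overline V_i^*,dx)$ and $\limsup_{n\to\infty}\mathcal E_i^{(n)}(u_n)\le\mathcal E_i^{(\infty)}(u)$. -/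

import Mathlib

open MeasureTheory Filter Topology
open scoped ENNReal NNReal

noncomputable section

namespace GraphDirected

/-! ### The weighted directed graph on the positive integers -/

/-- The kinds of edges leaving a vertex `i ≥ 1`: one edge to `2i` (`outer`), two edges to `2i-1`
(`left` and `right`, written `e` and `e'`), and, when `i ≥ 2`, one edge to `2i-2` (`inner`). -/
inductive EdgeKind
  | outer
  | left
  | right
  | inner
  deriving DecidableEq

/-- The terminal vertex of an edge leaving `i`. -/
def target (i : ℕ) : EdgeKind → ℕ
  | .outer => 2 * i
  | .left => 2 * i - 1
  | .right => 2 * i - 1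
  | .inner => 2 * i - 2

/-- The edges leaving `i`. -/
def edges (i : ℕ) : Finset EdgeKind :=
  if i = 1 then {.outer, .left, .right} else {.outer, .left, .right, .inner}

/-- Paths of length `n` starting at the vertex `i`, as lists of consecutive edges. -/
def paths : ℕ → ℕ → Finset (List EdgeKind)
  | 0, _ => {[]}
  | n + 1, i => (edges i).biUnion fun e => (paths n (target i e)).image (List.cons e)

/-- Edge weights: `r i j` is the weight of every edge from `i` to `j` (so the two edges from `i` to
`2i-1` carry the same weight). The weight of each existing edge is positive. -/
def PositiveWeights (r : ℕ → ℕ → ℝ) : Prop :=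
  ∀ i, 1 ≤ i → ∀ e ∈ edges i, 0 < r i (target i e)

/-- The resistance of a path starting at `i`: the product of the weights of its edges. -/
def resistance (r : ℕ → ℕ → ℝ) : ℕ → List EdgeKind → ℝ
  | _, [] => 1
  | i, e :: σ => r i (target i e) * resistance r (target i e) σ

/-! ### The discrete approximations and the physical spaces -/

/-- The shift of the affine map of an edge leaving `i`. -/
def shift (i : ℕ) : EdgeKind → ℝ
  | .outer => 0
  | .left => 0
  | .right => 1 / (2 * (i : ℝ))
  | .inner => 1 / (2 * (i : ℝ))

/-- The affine map `x ↦ (j / 2i) x + s_e` of an edge `e` from `i` to `j`. -/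
def edgeMap (i : ℕ) (e : EdgeKind) (x : ℝ) : ℝ :=
  (target i e : ℝ) / (2 * (i : ℝ)) * x + shift i e

/-- The affine map of a path starting at `i`; the map of the first edge is applied last. -/
def pathMap : ℕ → List EdgeKind → ℝ → ℝ
  | _, [], x => x
  | i, e :: σ, x => edgeMap i e (pathMap (target i e) σ x)

/-- The finite approximation `V_i^{(n)}`. -/
def nodes (i n : ℕ) : Finset ℝ :=
  (paths n i).biUnion fun σ => {pathMap i σ 0, pathMap i σ 1}

/-- `σ` is a path whose wire is the unordered pair `{x, y}`. -/
def Joins (i : ℕ) (σ : List EdgeKind) (x y : ℝ) : Prop :=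
  (x = pathMap i σ 0 ∧ y = pathMap i σ 1) ∨ (x = pathMap i σ 1 ∧ y = pathMap i σ 0)

/-- `{x, y}` is a wire of the `n`-th network, i.e. `{x, y} ∈ W_i^{(n)}`. -/
def IsWire (i n : ℕ) (x y : ℝ) : Prop :=
  ∃ σ ∈ paths n i, Joins i σ x y

/-- The physical space `[0, 1/i] ∪ [1 - 1/i, 1]`. -/
def physicalSpace (i : ℕ) : Set ℝ :=
  Set.Icc 0 (1 / (i : ℝ)) ∪ Set.Icc (1 - 1 / (i : ℝ)) 1

/-- Lebesgue measure on the physical space. -/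
def physicalMeasure (i : ℕ) : Measure ℝ :=
  volume.restrict (physicalSpace i)

open Classical in
/-- The cell `U_i^{(n)}(x)` of a node `x`. -/
def cell (i n : ℕ) (x : ℝ) : Set ℝ :=
  if i = 1 then Set.Ico (x - 1 / 2 ^ (n + 1)) (x + 1 / 2 ^ (n + 1)) ∩ Set.Icc 0 1
  else if x < 1 / (i : ℝ) then Set.Ico x (x + 1 / (2 ^ n * (i : ℝ)))
  else Set.Ioc (x - 1 / (2 ^ n * (i : ℝ))) x

/-- The mass `μ_i^{(n)}(x)` of a node `x`: the length of its cell. -/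
def mass (i n : ℕ) (x : ℝ) : ℝ := volume.real (cell i n x)

/-! ### Discrete energies -/

open Classical in
/-- The conductance between `x` and `y` at level `n`: the reciprocal resistance of the path whose
wire is `{x, y}` (there is exactly one such path), and `0` if `{x, y}` is not a wire. -/
def conductance (r : ℕ → ℕ → ℝ) (i n : ℕ) (x y : ℝ) : ℝ :=
  ∑ σ ∈ paths n i with Joins i σ x y, (resistance r i σ)⁻¹

/-- The discrete jump kernel `j_i^{(n)}`. -/
def jumpKernel (r : ℕ → ℕ → ℝ) (i n : ℕ) (x y : ℝ) : ℝ :=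
  conductance r i n x y / (mass i n x * mass i n y)

/-- The discrete energy `E_i^{(n)}` on `ℓ(V_i^{(n)})`. -/
def discreteEnergy (r : ℕ → ℕ → ℝ) (i n : ℕ) (u : nodes i n → ℝ) : ℝ :=
  ∑ x : nodes i n, ∑ y : nodes i n,
    (u x - u y) ^ 2 * jumpKernel r i n x y * mass i n x * mass i n y

/-- The two-sided kernel bounds with exponent `1 + 2s`, uniform in the level. -/
def KernelBounds (r : ℕ → ℕ → ℝ) (i : ℕ) (s : ℝ) : Prop :=
  (∃ Λ : ℝ, 0 < Λ ∧ ∀ (n : ℕ) (x y : ℝ), IsWire i n x y →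
    0 < jumpKernel r i n x y ∧ jumpKernel r i n x y ≤ Λ * |x - y| ^ (-(1 + 2 * s))) ∧
  (∃ l : ℝ, 0 < l ∧ ∀ (n : ℕ) (x y : ℝ), IsWire i n x y →
    l * |x - y| ^ (-(1 + 2 * s)) ≤ jumpKernel r i n x y)

/-! ### Extension, averaging and restriction -/

/-- The piecewise constant extension `Ext_i^{(n)}`. The cells of distinct nodes are disjoint and
cover the physical space up to at most two points. -/
def extend (i n : ℕ) (u : nodes i n → ℝ) (x : ℝ) : ℝ :=
  ∑ y : nodes i n, (cell i n y).indicator (fun _ => u y) x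

/-- The averaging operator `Avg_i^{(n)}`. -/
def average (i n : ℕ) (u : ℝ → ℝ) (x : nodes i n) : ℝ :=
  ⨍ z in cell i n x, u z

/-- Restriction of a function to the nodes. -/
def restrictNodes (i n : ℕ) (u : ℝ → ℝ) (x : nodes i n) : ℝ := u x

/-! ### The limit energy and generalized Gamma-convergence -/

/-- The limit energy with values in `[0, ∞]`: the limit of `E_i^{(n)}(Avg_i^{(n)} u)`. It depends
only on the class of `u` in `L²`. Its domain is the set of `u` at which it is finite. -/
def limitEnergy (r : ℕ → ℕ → ℝ) (i : ℕ) (u : ℝ → ℝ) : ℝ≥0∞ :=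
  limUnder atTop fun n => ENNReal.ofReal (discreteEnergy r i n (average i n u))

/-- The regular functions on which the limit energy is obtained by restriction to the nodes:
Lipschitz for `i = 1`, Hölder of order `1/2` for `i = 2`, continuous for `i > 2`. -/
def IsCore (i : ℕ) (f : ℝ → ℝ) : Prop :=
  if i = 1 then ∃ K : ℝ≥0, LipschitzOnWith K f (physicalSpace i)
  else if i = 2 then ∃ C : ℝ≥0, HolderOnWith C (1 / 2) f (physicalSpace i)
  else ContinuousOn f (physicalSpace i)

/-- Strong convergence `Ext_i^{(n)} u_n → u` in `L²` of the physical space. -/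
def StronglyConverges (i : ℕ) (u : (n : ℕ) → nodes i n → ℝ) (v : ℝ → ℝ) : Prop :=
  Tendsto (fun n => eLpNorm (fun x => extend i n (u n) x - v x) 2 (physicalMeasure i)) atTop (𝓝 0)

/-- Generalized Gamma-convergence of the discrete energies to a functional `E` on `L²`. -/
structure GammaConverges (r : ℕ → ℕ → ℝ) (i : ℕ) (E : (ℝ → ℝ) → ℝ≥0∞) : Prop where
  liminf_le : ∀ (u : (n : ℕ) → nodes i n → ℝ) (v : ℝ → ℝ), MemLp v 2 (physicalMeasure i) →
    StronglyConverges i u v →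
    E v ≤ liminf (fun n => ENNReal.ofReal (discreteEnergy r i n (u n))) atTop
  recovery : ∀ v : ℝ → ℝ, MemLp v 2 (physicalMeasure i) →
    ∃ u : (n : ℕ) → nodes i n → ℝ, StronglyConverges i u v ∧
      limsup (fun n => ENNReal.ofReal (discreteEnergy r i n (u n))) atTop ≤ E v

end GraphDirected

end

/-! Paths of length `n` from `i` correspond to pairs `(a, b)` of `n`-digit binary numbers with `a +
b < 2 ^ n * i`, the wire having ends `a / (2 ^ n * i)` and `1 - b / (2 ^ n * i)`. Hence for `i = 1`
any two distinct nodes are wired, and for `i ≥ 2` exactly the pairs from opposite ends of the space.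
The discrete energy is thus a discretised nonlocal form with kernel comparable to `|x - y| ^ (-(1 +
2 * s))` on the set `linked i`.

The energy is split by a cutoff near the diagonal. The cutoff is a finite sum of products of hat
functions with disjoint supports, so polarisation (`discreteEnergy_add`) writes the truncated energy
of a Lipschitz function through energies of Lipschitz functions, whose limits are assumed. Away from
the diagonal the kernel is bounded uniformly in the level, so the truncated energies are
equicontinuous quadratic forms on `ℓ²`. By density of Lipschitz functions they converge along every
strongly convergent sequence, to a limit `L m` depending only on the limit function
(`exists_tendsto_truncatedEnergy`). This gives `⨆ m, L m` as a lower bound for the liminf of the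
energies.

The matching upper bound needs small tails. If the Gagliardo integral of `u` over `linked i` is
finite, Jensen's inequality and the upper kernel bound dominate the energies of the averages by the
Gagliardo density (`dominates_average`), so the part near the diagonal is uniformly small and the
energies converge to `⨆ m, L m` (`tendsto_discreteEnergy_of_dominates`). If it is infinite, the
lower kernel bound and Fatou's lemma force the energies to infinity along every strongly convergent
sequence (`tendsto_discreteEnergy_top`). Both cases give the limit and the liminf inequality, and
the averages are a recovery sequence. For regular functions an explicit integrable majorant
(`exists_dominates_restrictNodes`) shows that restrictions have the same finite limit. -/

namespace GraphDirected

/-! ### Wires, nodes and cells in coordinates -/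

theorem target_pos {i : ℕ} (hi : 1 ≤ i) {e : EdgeKind} (he : e ∈ edges i) : 1 ≤ target i e := by
  unfold edges at he
  split_ifs at he with h
  · subst h
    cases e <;> simp_all [target]
  · cases e <;> simp only [target] <;> omega

/-- An edge prepends one binary digit `p` to `a` and one digit `q` to `b`; the four kinds of edges
are the four choices of `(p, q)`, and the target is `2 * i - p - q`. The condition `a + b < 2 ^ n *
i` is automatic for `i ≥ 2` and for `i = 1` says that the left end lies to the left of the right
end. -/
theorem pathMap_coordinates (n : ℕ) : ∀ i : ℕ, 1 ≤ i → ∀ σ ∈ paths n i, ∃ a b : ℕ,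
    a < 2 ^ n ∧ b < 2 ^ n ∧ a + b < 2 ^ n * i ∧
      pathMap i σ 0 = a / (2 ^ n * i) ∧ pathMap i σ 1 = 1 - b / (2 ^ n * i) := by
  induction n with
  | zero =>
    intro i hi σ hσ
    simp only [paths, Finset.mem_singleton] at hσ
    subst hσ
    exact ⟨0, 0, by simp, by simp, by simpa using Nat.pos_of_ne_zero (by omega),
      by simp [pathMap], by simp [pathMap]⟩
  | succ n ih =>
    intro i hi σ hσ
    simp only [paths, Finset.mem_biUnion, Finset.mem_image] at hσ
    obtain ⟨e, he, τ, hτ, rfl⟩ := hσ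
    have hj := target_pos hi he
    obtain ⟨a, b, ha, hb, hab, h0, h1⟩ := ih _ hj τ hτ
    have hi' : (0 : ℝ) < i := by exact_mod_cast hi
    have hj' : (0 : ℝ) < target i e := by exact_mod_cast hj
    have key : ∀ p q : ℕ, p ≤ 1 → q ≤ 1 → target i e + (p + q) = 2 * i →
        shift i e = p / (2 * i) → ∃ a' b' : ℕ,
          a' < 2 ^ (n + 1) ∧ b' < 2 ^ (n + 1) ∧ a' + b' < 2 ^ (n + 1) * i ∧
          pathMap i (e :: τ) 0 = a' / (2 ^ (n + 1) * i) ∧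
          pathMap i (e :: τ) 1 = 1 - b' / (2 ^ (n + 1) * i) := by
      intro p q hp hq hpq hs
      have hpq' : (target i e : ℝ) + (p + q) = 2 * i := by exact_mod_cast hpq
      refine ⟨a + p * 2 ^ n, b + q * 2 ^ n, ?_, ?_, ?_, ?_, ?_⟩
      · have := Nat.mul_le_mul_right (2 ^ n) hp
        rw [pow_succ]; omega
      · have := Nat.mul_le_mul_right (2 ^ n) hq
        rw [pow_succ]; omega
      · have : 2 ^ (n + 1) * i = 2 ^ n * target i e + p * 2 ^ n + q * 2 ^ n := by
          rw [pow_succ, mul_assoc, ← hpq]; ring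
        omega
      · simp only [pathMap, edgeMap, h0, hs]
        push_cast
        field_simp
        ring
      · simp only [pathMap, edgeMap, h1, hs]
        push_cast
        have : (q : ℝ) = 2 * i - target i e - p := by linarith
        rw [this]
        field_simp
        ring
    cases e with
    | outer => exact key 0 0 (by simp) (by simp) (by simp [target]) (by simp [shift])
    | left => exact key 0 1 (by simp) (by simp) (by simp only [target]; omega) (by simp [shift])
    | right => exact key 1 0 (by simp) (by simp) (by simp only [target]; omega) (by simp [shift])
    | inner => exact key 1 1 (by simp) (by simp) (by simp only [target]; omega) (by simp [shift])

/-- The leading digits of `a` and `b` determine the first edge, and the remaining digits are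
coordinates for the target vertex. -/
theorem exists_path_of_coordinates (n : ℕ) : ∀ i : ℕ, 1 ≤ i → ∀ a b : ℕ, a < 2 ^ n → b < 2 ^ n →
    a + b < 2 ^ n * i → ∃ σ ∈ paths n i,
      pathMap i σ 0 = a / (2 ^ n * i) ∧ pathMap i σ 1 = 1 - b / (2 ^ n * i) := by
  induction n with
  | zero =>
    intro i hi a b ha hb _
    obtain rfl : a = 0 := by simpa using ha
    obtain rfl : b = 0 := by simpa using hb
    exact ⟨[], by simp [paths], by simp [pathMap], by simp [pathMap]⟩
  | succ n ih =>
    intro i hi a b ha hb hab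
    have key : ∀ e ∈ edges i, ∀ p q a' b' : ℕ, target i e + (p + q) = 2 * i →
        shift i e = p / (2 * i) → a = a' + p * 2 ^ n → b = b' + q * 2 ^ n →
        a' < 2 ^ n → b' < 2 ^ n → ∃ σ ∈ paths (n + 1) i,
          pathMap i σ 0 = a / (2 ^ (n + 1) * i) ∧ pathMap i σ 1 = 1 - b / (2 ^ (n + 1) * i) := by
      intro e he p q a' b' hpq hs ha' hb' ha1 hb1
      have hj := target_pos hi he
      have hab' : a' + b' < 2 ^ n * target i e := by
        have : 2 ^ (n + 1) * i = 2 ^ n * target i e + p * 2 ^ n + q * 2 ^ n := by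
          rw [pow_succ, mul_assoc, ← hpq]; ring
        omega
      obtain ⟨τ, hτ, h0, h1⟩ := ih _ hj a' b' ha1 hb1 hab'
      have hi' : (0 : ℝ) < i := by exact_mod_cast hi
      have hj' : (0 : ℝ) < target i e := by exact_mod_cast hj
      have hpq' : (target i e : ℝ) + (p + q) = 2 * i := by exact_mod_cast hpq
      refine ⟨e :: τ, ?_, ?_, ?_⟩
      · simp only [paths, Finset.mem_biUnion, Finset.mem_image]
        exact ⟨e, he, τ, hτ, rfl⟩
      · simp only [pathMap, edgeMap, h0, hs, ha']
        push_cast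
        field_simp
        ring
      · simp only [pathMap, edgeMap, h1, hs, hb']
        push_cast
        have : (q : ℝ) = 2 * i - target i e - p := by linarith
        rw [this]
        field_simp
        ring
    have h2 : (2 : ℕ) ^ (n + 1) = 2 ^ n + 2 ^ n := by rw [pow_succ]; ring
    rcases lt_or_ge a (2 ^ n) with h | h <;> rcases lt_or_ge b (2 ^ n) with h' | h'
    · exact key .outer (by unfold edges; split_ifs <;> simp) 0 0 a b (by simp [target])
        (by simp [shift]) (by simp) (by simp) h h'
    · exact key .left (by unfold edges; split_ifs <;> simp) 0 1 a (b - 2 ^ n)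
        (by simp only [target]; omega) (by simp [shift]) (by simp) (by omega) h (by omega)
    · exact key .right (by unfold edges; split_ifs <;> simp) 1 0 (a - 2 ^ n) b
        (by simp only [target]; omega) (by simp [shift]) (by omega) (by simp) (by omega) h'
    -- At `i = 1` there is no inner edge, but there two leading digits `1` would already violate `a
    -- + b < 2 ^ (n + 1)`.
    · have hi2 : i ≠ 1 := by rintro rfl; omega
      exact key .inner (by unfold edges; rw [if_neg hi2]; simp) 1 1 (a - 2 ^ n) (b - 2 ^ n)
        (by simp only [target]; omega) (by simp [shift]) (by omega) (by omega) (by omega)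
        (by omega)

theorem isWire_iff {i n : ℕ} (hi : 1 ≤ i) {x y : ℝ} : IsWire i n x y ↔
    ∃ a b : ℕ, a < 2 ^ n ∧ b < 2 ^ n ∧ a + b < 2 ^ n * i ∧
      ((x = a / (2 ^ n * i) ∧ y = 1 - b / (2 ^ n * i)) ∨
        (x = 1 - b / (2 ^ n * i) ∧ y = a / (2 ^ n * i))) := by
  constructor
  · rintro ⟨σ, hσ, h⟩
    obtain ⟨a, b, ha, hb, hab, h0, h1⟩ := pathMap_coordinates n i hi σ hσ
    exact ⟨a, b, ha, hb, hab, by rwa [Joins, h0, h1] at h⟩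
  · rintro ⟨a, b, ha, hb, hab, h⟩
    obtain ⟨σ, hσ, h0, h1⟩ := exists_path_of_coordinates n i hi a b ha hb hab
    exact ⟨σ, hσ, by rwa [Joins, h0, h1]⟩

theorem mem_nodes_iff {i n : ℕ} (hi : 1 ≤ i) {x : ℝ} : x ∈ nodes i n ↔
    ∃ a : ℕ, a < 2 ^ n ∧ (x = a / (2 ^ n * i) ∨ x = 1 - a / (2 ^ n * i)) := by
  simp only [nodes, Finset.mem_biUnion, Finset.mem_insert, Finset.mem_singleton]
  have h2 : 2 ^ n ≤ 2 ^ n * i := Nat.le_mul_of_pos_right _ hi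
  have h3 : 0 < 2 ^ n := by positivity
  constructor
  · rintro ⟨σ, hσ, h⟩
    obtain ⟨a, b, ha, hb, hab, h0, h1⟩ := pathMap_coordinates n i hi σ hσ
    rw [h0, h1] at h
    rcases h with h | h
    · exact ⟨a, ha, .inl h⟩
    · exact ⟨b, hb, .inr h⟩
  · rintro ⟨a, ha, h | h⟩
    · obtain ⟨σ, hσ, h0, h1⟩ := exists_path_of_coordinates n i hi a 0 ha h3 (by omega)
      exact ⟨σ, hσ, .inl (by rw [h0, h])⟩
    · obtain ⟨σ, hσ, h0, h1⟩ := exists_path_of_coordinates n i hi 0 a h3 ha (by omega)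
      exact ⟨σ, hσ, .inr (by rw [h1, h])⟩

theorem IsWire.symm {i n : ℕ} {x y : ℝ} (h : IsWire i n x y) : IsWire i n y x := by
  obtain ⟨σ, hσ, h | h⟩ := h
  · exact ⟨σ, hσ, .inr ⟨h.2, h.1⟩⟩
  · exact ⟨σ, hσ, .inl ⟨h.2, h.1⟩⟩

theorem mem_nodes_one_iff {n : ℕ} {x : ℝ} :
    x ∈ nodes 1 n ↔ ∃ a : ℕ, a ≤ 2 ^ n ∧ x = a / 2 ^ n := by
  have h3 : 0 < 2 ^ n := by positivity
  rw [mem_nodes_iff le_rfl]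
  simp only [Nat.cast_one, mul_one]
  constructor
  · rintro ⟨a, ha, h | h⟩
    · exact ⟨a, ha.le, h⟩
    · refine ⟨2 ^ n - a, by omega, ?_⟩
      rw [h, Nat.cast_sub ha.le]
      push_cast
      field_simp
  · rintro ⟨a, ha, h⟩
    rcases ha.lt_or_eq with ha | ha
    · exact ⟨a, ha, .inl h⟩
    · exact ⟨0, by omega, .inr (by rw [h, ha]; simp)⟩

theorem isWire_one_iff {n : ℕ} {x y : ℝ} :
    IsWire 1 n x y ↔ x ∈ nodes 1 n ∧ y ∈ nodes 1 n ∧ x ≠ y := by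
  have h3 : (0 : ℝ) < 2 ^ n := by positivity
  rw [isWire_iff le_rfl, mem_nodes_one_iff, mem_nodes_one_iff]
  simp only [Nat.cast_one, mul_one]
  have key : ∀ b : ℕ, b < 2 ^ n → (1 : ℝ) - b / 2 ^ n = ((2 ^ n - b : ℕ) : ℝ) / 2 ^ n := by
    intro b hb
    rw [Nat.cast_sub hb.le]
    push_cast
    field_simp
  have hne : ∀ a b : ℕ, a ≠ b → (a : ℝ) / 2 ^ n ≠ b / 2 ^ n := by
    intro a b hab h
    rw [div_left_inj' h3.ne'] at h
    exact hab (by exact_mod_cast h)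
  constructor
  · rintro ⟨a, b, ha, hb, hab, ⟨rfl, rfl⟩ | ⟨rfl, rfl⟩⟩
    · rw [key b hb]
      exact ⟨⟨a, ha.le, rfl⟩, ⟨_, Nat.sub_le _ _, rfl⟩, hne _ _ (by omega)⟩
    · rw [key b hb]
      exact ⟨⟨_, Nat.sub_le _ _, rfl⟩, ⟨a, ha.le, rfl⟩, hne _ _ (by omega)⟩
  · rintro ⟨⟨a, ha, rfl⟩, ⟨b, hb, rfl⟩, hne'⟩
    have hab : a ≠ b := by rintro rfl; exact hne' rfl
    rcases lt_or_gt_of_ne hab with h | h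
    · refine ⟨a, 2 ^ n - b, by omega, by omega, by omega, .inl ⟨rfl, ?_⟩⟩
      rw [key _ (by omega)]
      congr 2; omega
    · refine ⟨b, 2 ^ n - a, by omega, by omega, by omega, .inr ⟨?_, rfl⟩⟩
      rw [key _ (by omega)]
      congr 2; omega

theorem IsWire.left_mem {i n : ℕ} (hi : 1 ≤ i) {x y : ℝ} (h : IsWire i n x y) :
    x ∈ nodes i n := by
  obtain ⟨a, b, ha, hb, -, h | h⟩ := (isWire_iff hi).1 h
  · exact (mem_nodes_iff hi).2 ⟨a, ha, .inl h.1⟩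
  · exact (mem_nodes_iff hi).2 ⟨b, hb, .inr h.1⟩

theorem IsWire.right_mem {i n : ℕ} (hi : 1 ≤ i) {x y : ℝ} (h : IsWire i n x y) :
    y ∈ nodes i n := h.symm.left_mem hi

/-- Pairs of points that wires may join: all pairs if `i = 1`, and otherwise pairs of points from
different ends of the physical space. -/
def linked (i : ℕ) : Set (ℝ × ℝ) :=
  if i = 1 then Set.univ
  else {p | (p.1 < 1 / (i : ℝ) ∧ 1 - 1 / (i : ℝ) < p.2) ∨
    (1 - 1 / (i : ℝ) < p.1 ∧ p.2 < 1 / (i : ℝ))}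

theorem measurableSet_linked (i : ℕ) : MeasurableSet (linked i) := by
  unfold linked
  split_ifs
  · exact MeasurableSet.univ
  · exact ((measurableSet_lt measurable_fst measurable_const).inter
      (measurableSet_lt measurable_const measurable_snd)).union
      ((measurableSet_lt measurable_const measurable_fst).inter
      (measurableSet_lt measurable_snd measurable_const))

theorem physicalSpace_one : physicalSpace 1 = Set.Icc 0 1 := by
  simp [physicalSpace]

theorem inv_le_one_sub_inv {i : ℕ} (hi : 2 ≤ i) : 1 / (i : ℝ) ≤ 1 - 1 / (i : ℝ) := by
  have : (2 : ℝ) ≤ i := by exact_mod_cast hi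
  have h := one_div_le_one_div_of_le (by norm_num) this
  linarith

/-- For `i ≥ 2` the nodes fall into the two ends of the physical space. -/
theorem node_cases {i n : ℕ} (hi : 2 ≤ i) {x : ℝ} (hx : x ∈ nodes i n) :
    (∃ a : ℕ, a < 2 ^ n ∧ x = a / (2 ^ n * i) ∧ x + 1 / (2 ^ n * i) ≤ 1 / i ∧ 0 ≤ x ∧
      cell i n x = Set.Ico x (x + 1 / (2 ^ n * i))) ∨
    (∃ b : ℕ, b < 2 ^ n ∧ x = 1 - b / (2 ^ n * i) ∧ 1 - 1 / i ≤ x - 1 / (2 ^ n * i) ∧ x ≤ 1 ∧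
      cell i n x = Set.Ioc (x - 1 / (2 ^ n * i)) x) := by
  have hi' : (0 : ℝ) < i := by exact_mod_cast (by omega : 0 < i)
  have hN : (0 : ℝ) < 2 ^ n * i := by positivity
  have key : ∀ a : ℕ, a < 2 ^ n → (a : ℝ) / (2 ^ n * i) + 1 / (2 ^ n * i) ≤ 1 / i := by
    intro a ha
    have : (a : ℝ) + 1 ≤ 2 ^ n := by exact_mod_cast ha
    rw [← add_div, div_le_div_iff₀ hN hi']
    nlinarith
  have hs : (0 : ℝ) < 1 / (2 ^ n * i) := by positivity
  obtain ⟨a, ha, h | h⟩ := (mem_nodes_iff (by omega : 1 ≤ i)).1 hx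
  · have h1 := key a ha
    refine .inl ⟨a, ha, h, by rwa [h], by rw [h]; positivity, ?_⟩
    rw [cell, if_neg (by omega), if_pos (by rw [h]; linarith)]
  · have h1 := key a ha
    have h2 := inv_le_one_sub_inv hi
    refine .inr ⟨a, ha, h, by rw [h]; linarith, ?_, ?_⟩
    · rw [h]
      have : (0 : ℝ) ≤ a / (2 ^ n * i) := by positivity
      linarith
    · rw [cell, if_neg (by omega), if_neg (by rw [h, not_lt]; linarith)]

/-! ### Cells: size, mass, disjointness and covering. -/

theorem measurableSet_cell (i n : ℕ) (x : ℝ) : MeasurableSet (cell i n x) := by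
  unfold cell
  split_ifs
  · exact measurableSet_Ico.inter measurableSet_Icc
  · exact measurableSet_Ico
  · exact measurableSet_Ioc

theorem cell_subset {i n : ℕ} (hi : 1 ≤ i) {x : ℝ} (hx : x ∈ nodes i n) :
    cell i n x ⊆ physicalSpace i := by
  rcases hi.eq_or_lt with rfl | hi2
  · rw [cell, if_pos rfl, physicalSpace_one]
    exact Set.inter_subset_right
  · rcases node_cases hi2 hx with ⟨a, ha, -, h1, h0, hc⟩ | ⟨a, ha, -, h1, h0, hc⟩
    · rw [hc]
      exact fun z hz => .inl ⟨h0.trans hz.1, hz.2.le.trans h1⟩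
    · rw [hc]
      exact fun z hz => .inr ⟨h1.trans hz.1.le, hz.2.trans h0⟩

theorem self_mem_cell {i n : ℕ} (hi : 1 ≤ i) {x : ℝ} (hx : x ∈ nodes i n) :
    x ∈ cell i n x := by
  rcases hi.eq_or_lt with rfl | hi2
  · rw [cell, if_pos rfl]
    obtain ⟨a, ha, rfl⟩ := mem_nodes_one_iff.1 hx
    have h0 : (0 : ℝ) < 1 / 2 ^ (n + 1) := by positivity
    have ha' : (a : ℝ) ≤ 2 ^ n := by exact_mod_cast ha
    exact ⟨⟨by linarith, by linarith⟩, by positivity, div_le_one_of_le₀ ha' (by positivity)⟩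
  · have hi' : (0 : ℝ) < i := by exact_mod_cast (by omega : 0 < i)
    have hs : (0 : ℝ) < 1 / (2 ^ n * i) := by positivity
    rcases node_cases hi2 hx with ⟨a, ha, -, h1, h0, hc⟩ | ⟨a, ha, -, h1, h0, hc⟩
    · rw [hc]
      exact ⟨le_rfl, by linarith⟩
    · rw [hc]
      exact ⟨by linarith, le_rfl⟩

theorem node_mem_physicalSpace {i n : ℕ} (hi : 1 ≤ i) {x : ℝ} (hx : x ∈ nodes i n) :
    x ∈ physicalSpace i := cell_subset hi hx (self_mem_cell hi hx)

theorem inv_level_le {i : ℕ} (hi : 1 ≤ i) (n : ℕ) : 1 / (2 ^ n * (i : ℝ)) ≤ 1 / 2 ^ n := by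
  have hi' : (1 : ℝ) ≤ i := by exact_mod_cast hi
  have h2 : (0 : ℝ) < 2 ^ n := by positivity
  exact one_div_le_one_div_of_le h2 (by nlinarith)

theorem abs_sub_le_of_mem_cell {i n : ℕ} (hi : 1 ≤ i) {x z : ℝ}
    (hz : z ∈ cell i n x) : |z - x| ≤ 1 / 2 ^ n := by
  have h := inv_level_le hi n
  have h' : (1 : ℝ) / 2 ^ (n + 1) ≤ 1 / 2 ^ n :=
    one_div_le_one_div_of_le (by positivity) (by rw [pow_succ]; linarith [pow_pos (zero_lt_two' ℝ) n])
  have h0 : (0 : ℝ) < 1 / 2 ^ n := by positivity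
  unfold cell at hz
  split_ifs at hz
  · rw [abs_le]
    constructor <;> linarith [hz.1.1, hz.1.2]
  · rw [abs_le]
    constructor <;> linarith [hz.1, hz.2]
  · rw [abs_le]
    constructor <;> linarith [hz.1, hz.2]

theorem abs_sub_le_half_of_mem_cell_one {n : ℕ} {x z : ℝ} (hz : z ∈ cell 1 n x) :
    |z - x| ≤ 1 / 2 / 2 ^ n := by
  have h' : (1 : ℝ) / 2 ^ (n + 1) = 1 / 2 / 2 ^ n := by rw [pow_succ]; field_simp
  rw [cell, if_pos rfl, h'] at hz
  rw [abs_le]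
  constructor <;> linarith [hz.1.1, hz.1.2]

theorem mass_pos {i n : ℕ} (hi : 1 ≤ i) {x : ℝ} (hx : x ∈ nodes i n) : 0 < mass i n x := by
  unfold mass
  have hi' : (0 : ℝ) < i := by exact_mod_cast hi
  have hs : (0 : ℝ) < 1 / (2 ^ n * i) := by positivity
  rcases hi.eq_or_lt with rfl | hi2
  · rw [cell, if_pos rfl]
    obtain ⟨a, ha, hxa⟩ := mem_nodes_one_iff.1 hx
    have h0 : (0 : ℝ) < 1 / 2 ^ (n + 1) := by positivity
    have ha' : (a : ℝ) ≤ 2 ^ n := by exact_mod_cast ha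
    have hx0 : 0 ≤ x := by rw [hxa]; positivity
    have hx1 : x ≤ 1 := by rw [hxa]; exact div_le_one_of_le₀ ha' (by positivity)
    -- The boundary nodes `0` and `1` keep only half a cell, so positivity is read off the interval
    -- clipped to `[0, 1]`.
    have hsub : Set.Ioo (max (x - 1 / 2 ^ (n + 1)) 0) (min (x + 1 / 2 ^ (n + 1)) 1) ⊆
        Set.Ico (x - 1 / 2 ^ (n + 1)) (x + 1 / 2 ^ (n + 1)) ∩ Set.Icc 0 1 := by
      intro z hz
      simp only [Set.mem_Ioo, max_lt_iff, lt_min_iff] at hz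
      exact ⟨⟨hz.1.1.le, hz.2.1⟩, hz.1.2.le, hz.2.2.le⟩
    have hlt : max (x - 1 / 2 ^ (n + 1)) 0 < min (x + 1 / 2 ^ (n + 1)) 1 := by
      simp only [max_lt_iff, lt_min_iff]
      have h2 : (1 : ℝ) / 2 ^ (n + 1) < 1 := by
        rw [div_lt_one (by positivity)]
        exact one_lt_pow₀ (by norm_num) (by omega)
      refine ⟨⟨by linarith, by linarith⟩, by linarith, by norm_num⟩
    have hfin : volume (Set.Ico (x - 1 / 2 ^ (n + 1)) (x + 1 / 2 ^ (n + 1)) ∩ Set.Icc 0 1) ≠ ∞ :=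
      ((measure_mono Set.inter_subset_left).trans_lt measure_Ico_lt_top).ne
    refine lt_of_lt_of_le ?_ (measureReal_mono hsub hfin)
    rw [Real.volume_real_Ioo_of_le hlt.le]
    linarith
  · rcases node_cases hi2 hx with ⟨a, ha, -, h1, h0, hc⟩ | ⟨a, ha, -, h1, h0, hc⟩
    · rw [hc, Real.volume_real_Ico_of_le (by linarith)]
      linarith
    · rw [hc, Real.volume_real_Ioc_of_le (by linarith)]
      linarith

/-- A cell on the left end determines its node. -/
theorem floor_of_mem_left {N z : ℝ} (hN : 0 < N) {a : ℕ} (h1 : (a : ℝ) / N ≤ z)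
    (h2 : z < a / N + 1 / N) : ⌊N * z⌋ = a := by
  rw [← add_div] at h2
  rw [div_le_iff₀' hN] at h1
  rw [lt_div_iff₀' hN] at h2
  rw [Int.floor_eq_iff]
  exact ⟨by exact_mod_cast h1, by exact_mod_cast h2⟩

theorem exists_left_index {N : ℕ} {m : ℕ} (hN : 0 < N) {z : ℝ} (hz : 0 ≤ z) (hz' : z * N < m) :
    ∃ a : ℕ, a < m ∧ (a : ℝ) / N ≤ z ∧ z < a / N + 1 / N := by
  have hN' : (0 : ℝ) < N := by exact_mod_cast hN
  have h0 : 0 ≤ z * N := by positivity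
  refine ⟨⌊z * N⌋₊, ?_, ?_, ?_⟩
  · have := Nat.floor_le h0
    exact_mod_cast this.trans_lt hz'
  · rw [div_le_iff₀ hN']
    exact Nat.floor_le h0
  · rw [← add_div, lt_div_iff₀ hN']
    exact Nat.lt_floor_add_one _

theorem cell_disjoint {i n : ℕ} (hi : 1 ≤ i) {x y : ℝ} (hx : x ∈ nodes i n) (hy : y ∈ nodes i n)
    (hxy : x ≠ y) : Disjoint (cell i n x) (cell i n y) := by
  rw [Set.disjoint_left]
  intro z hzx hzy
  apply hxy
  rcases hi.eq_or_lt with rfl | hi2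
  · obtain ⟨a, ha, rfl⟩ := mem_nodes_one_iff.1 hx
    obtain ⟨b, hb, rfl⟩ := mem_nodes_one_iff.1 hy
    rw [cell, if_pos rfl] at hzx hzy
    have hN : (0 : ℝ) < 2 ^ n := by positivity
    have hs : (1 : ℝ) / 2 ^ (n + 1) + 1 / 2 ^ (n + 1) = 1 / 2 ^ n := by
      rw [pow_succ]; field_simp; norm_num
    -- Shifting by half a mesh turns the centred cells into cells starting at their nodes.
    have e1 := floor_of_mem_left (z := z + 1 / 2 ^ (n + 1)) hN (a := a)
      (by linarith [hzx.1.1]) (by linarith [hzx.1.2])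
    have e2 := floor_of_mem_left (z := z + 1 / 2 ^ (n + 1)) hN (a := b)
      (by linarith [hzy.1.1]) (by linarith [hzy.1.2])
    have : (a : ℤ) = b := e1.symm.trans e2
    rw [show a = b by exact_mod_cast this]
  · have hi' : (0 : ℝ) < i := by exact_mod_cast (by omega : 0 < i)
    have hN : (0 : ℝ) < 2 ^ n * i := by positivity
    have h2 := inv_le_one_sub_inv hi2
    rcases node_cases hi2 hx with ⟨a, ha, hxa, h1, h0, hc⟩ | ⟨a, ha, hxa, h1, h0, hc⟩ <;>
    rcases node_cases hi2 hy with ⟨b, hb, hyb, h1', h0', hc'⟩ | ⟨b, hb, hyb, h1', h0', hc'⟩ <;>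
    rw [hc] at hzx <;> rw [hc'] at hzy
    · have e1 := floor_of_mem_left (z := z) hN (by rw [← hxa]; exact hzx.1) (by rw [← hxa]; exact hzx.2)
      have e2 := floor_of_mem_left (z := z) hN (by rw [← hyb]; exact hzy.1) (by rw [← hyb]; exact hzy.2)
      have : (a : ℤ) = b := e1.symm.trans e2
      rw [hxa, hyb, show a = b by exact_mod_cast this]
    · linarith [hzx.2, hzy.1]
    · linarith [hzy.2, hzx.1]
    -- The reflection `z ↦ 1 - z` carries right cells to left cells.
    · have e1 := floor_of_mem_left (z := 1 - z) (a := a) hN (by linarith [hzx.2])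
        (by linarith [hzx.1])
      have e2 := floor_of_mem_left (z := 1 - z) (a := b) hN (by linarith [hzy.2])
        (by linarith [hzy.1])
      have : (a : ℤ) = b := e1.symm.trans e2
      rw [hxa, hyb, show a = b by exact_mod_cast this]

/-- For `i ≥ 2` the half-open cells miss precisely the inner ends `1 / i` and `1 - 1 / i`, which
form a null set. -/
theorem exists_mem_cell {i : ℕ} (hi : 1 ≤ i) (n : ℕ) {z : ℝ} (hz : z ∈ physicalSpace i)
    (h1 : i = 1 ∨ (z ≠ 1 / i ∧ z ≠ 1 - 1 / i)) : ∃ x ∈ nodes i n, z ∈ cell i n x := by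
  have hN : (0 : ℝ) < 2 ^ n := by positivity
  rcases hi.eq_or_lt with rfl | hi2
  · rw [physicalSpace_one] at hz
    have hs : (1 : ℝ) / 2 ^ (n + 1) + 1 / 2 ^ (n + 1) = 1 / 2 ^ n := by
      rw [pow_succ]; field_simp; norm_num
    have hs0 : (0 : ℝ) < 1 / 2 ^ (n + 1) := by positivity
    have hs1 : (1 : ℝ) / 2 ^ (n + 1) * 2 ^ n < 1 := by
      rw [pow_succ]; field_simp; norm_num
    obtain ⟨a, ha, h3, h4⟩ := exists_left_index (N := 2 ^ n) (m := 2 ^ n + 1) (by positivity)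
      (z := z + 1 / 2 ^ (n + 1)) (by linarith [hz.1]) (by
        push_cast
        have := mul_le_mul_of_nonneg_right hz.2 hN.le
        rw [add_mul]; linarith)
    push_cast at h3 h4
    refine ⟨a / 2 ^ n, mem_nodes_one_iff.2 ⟨a, by omega, rfl⟩, ?_⟩
    rw [cell, if_pos rfl]
    exact ⟨⟨by linarith, by linarith⟩, hz⟩
  · have hi' : (0 : ℝ) < i := by exact_mod_cast (by omega : 0 < i)
    have hne := h1.resolve_left (by omega)
    have hNN : 0 < 2 ^ n * i := by positivity
    have key : ∀ t : ℝ, 0 ≤ t → t ≤ 1 / i → t ≠ 1 / i → ∃ a : ℕ, a < 2 ^ n ∧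
        (a : ℝ) / (2 ^ n * i) ≤ t ∧ t < a / (2 ^ n * i) + 1 / (2 ^ n * i) := by
      intro t ht0 ht1 ht2
      have := exists_left_index (m := 2 ^ n) hNN ht0 (by
        have := lt_of_le_of_ne ht1 ht2
        rw [lt_div_iff₀ hi'] at this
        push_cast
        nlinarith)
      push_cast at this
      exact this
    rcases hz with hz | hz
    · obtain ⟨a, ha, h3, h4⟩ := key z hz.1 hz.2 hne.1
      refine ⟨_, (mem_nodes_iff hi).2 ⟨a, ha, .inl rfl⟩, ?_⟩
      rw [cell, if_neg (by omega), if_pos]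
      · exact ⟨h3, h4⟩
      · exact h3.trans_lt (lt_of_le_of_ne hz.2 hne.1)
    · obtain ⟨a, ha, h3, h4⟩ := key (1 - z) (by linarith [hz.2]) (by linarith [hz.1])
        (fun h => hne.2 (by linarith))
      refine ⟨_, (mem_nodes_iff hi).2 ⟨a, ha, .inr rfl⟩, ?_⟩
      rw [cell, if_neg (by omega), if_neg]
      · exact ⟨by linarith, by linarith⟩
      · have h5 := lt_of_le_of_ne hz.1 (Ne.symm hne.2)
        have := inv_le_one_sub_inv hi2
        rw [not_lt]
        linarith

instance isFiniteMeasure_physicalMeasure (i : ℕ) : IsFiniteMeasure (physicalMeasure i) := by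
  refine ⟨?_⟩
  rw [physicalMeasure, Measure.restrict_apply_univ]
  exact (isCompact_Icc.union isCompact_Icc).measure_lt_top

theorem measurableSet_physicalSpace (i : ℕ) : MeasurableSet (physicalSpace i) :=
  measurableSet_Icc.union measurableSet_Icc

theorem isCompact_physicalSpace (i : ℕ) : IsCompact (physicalSpace i) :=
  isCompact_Icc.union isCompact_Icc

theorem physicalSpace_subset {i : ℕ} (hi : 1 ≤ i) : physicalSpace i ⊆ Set.Icc 0 1 := by
  have hi' : (1 : ℝ) ≤ i := by exact_mod_cast hi
  have h1 : 1 / (i : ℝ) ≤ 1 := div_le_one_of_le₀ hi' (by positivity)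
  rintro z (hz | hz)
  · exact ⟨hz.1, hz.2.trans h1⟩
  · exact ⟨by linarith [hz.1], hz.2⟩

theorem ae_mem_cell {i : ℕ} (hi : 1 ≤ i) :
    ∀ᵐ z ∂physicalMeasure i, ∀ n, ∃ x ∈ nodes i n, z ∈ cell i n x := by
  have h1 : ∀ᵐ z ∂physicalMeasure i, z ∈ physicalSpace i :=
    ae_restrict_mem (measurableSet_physicalSpace i)
  have h2 : ∀ c : ℝ, ∀ᵐ z ∂physicalMeasure i, z ≠ c := fun c =>
    ae_restrict_of_ae (Measure.ae_ne volume c)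
  filter_upwards [h1, h2 (1 / i), h2 (1 - 1 / i)] with z hz ha hb n
  exact exists_mem_cell hi n hz (.inr ⟨ha, hb⟩)

/-! ### Position of the cells at the two ends of a wire. -/

theorem IsWire.ne {i n : ℕ} (hi : 1 ≤ i) {x y : ℝ} (h : IsWire i n x y) : x ≠ y := by
  have hi' : (0 : ℝ) < i := by exact_mod_cast hi
  have hN : (0 : ℝ) < 2 ^ n * i := by positivity
  have key : ∀ a b : ℕ, a + b < 2 ^ n * i → (a : ℝ) / (2 ^ n * i) ≠ 1 - b / (2 ^ n * i) := by
    intro a b hab he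
    have h1 : (a : ℝ) + b < 2 ^ n * i := by exact_mod_cast hab
    rw [eq_sub_iff_add_eq, ← add_div, div_eq_one_iff_eq hN.ne'] at he
    linarith
  obtain ⟨a, b, ha, hb, hab, ⟨rfl, rfl⟩ | ⟨rfl, rfl⟩⟩ := (isWire_iff hi).1 h
  · exact key a b hab
  · exact (key a b hab).symm

theorem IsWire.node_sides {i n : ℕ} (hi : 2 ≤ i) {x y : ℝ} (h : IsWire i n x y) :
    (cell i n x = Set.Ico x (x + 1 / (2 ^ n * i)) ∧ x + 1 / (2 ^ n * i) ≤ 1 / i ∧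
      cell i n y = Set.Ioc (y - 1 / (2 ^ n * i)) y ∧ 1 - 1 / i ≤ y - 1 / (2 ^ n * i)) ∨
    (cell i n y = Set.Ico y (y + 1 / (2 ^ n * i)) ∧ y + 1 / (2 ^ n * i) ≤ 1 / i ∧
      cell i n x = Set.Ioc (x - 1 / (2 ^ n * i)) x ∧ 1 - 1 / i ≤ x - 1 / (2 ^ n * i)) := by
  have hi1 : 1 ≤ i := by omega
  have hi' : (0 : ℝ) < i := by exact_mod_cast (by omega : 0 < i)
  have hN : (0 : ℝ) < 2 ^ n * i := by positivity
  have hs : (0 : ℝ) < 1 / (2 ^ n * i) := by positivity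
  have h2 := inv_le_one_sub_inv hi
  have keyL : ∀ a : ℕ, a < 2 ^ n → (a : ℝ) / (2 ^ n * i) < 1 / i := by
    intro a ha
    have : (a : ℝ) < 2 ^ n := by exact_mod_cast ha
    rw [div_lt_div_iff₀ hN hi']
    nlinarith
  obtain ⟨a, b, ha, hb, hab, ⟨hx, hy⟩ | ⟨hx, hy⟩⟩ := (isWire_iff hi1).1 h
  · have ka := keyL a ha
    have kb := keyL b hb
    left
    rcases node_cases hi (h.left_mem hi1) with ⟨_, _, _, h1, _, hc⟩ | ⟨_, _, _, h1, _, hc⟩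
    · rcases node_cases hi (h.right_mem hi1) with ⟨_, _, _, h1', _, hc'⟩ | ⟨_, _, _, h1', _, hc'⟩
      · linarith
      · exact ⟨hc, h1, hc', h1'⟩
    · linarith
  · have ka := keyL a ha
    have kb := keyL b hb
    right
    rcases node_cases hi (h.right_mem hi1) with ⟨_, _, _, h1, _, hc⟩ | ⟨_, _, _, h1, _, hc⟩
    · rcases node_cases hi (h.left_mem hi1) with ⟨_, _, _, h1', _, hc'⟩ | ⟨_, _, _, h1', _, hc'⟩
      · linarith
      · exact ⟨hc, h1, hc', h1'⟩
    · linarith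

theorem level_le_abs_sub {n : ℕ} {x y : ℝ} (hx : x ∈ nodes 1 n) (hy : y ∈ nodes 1 n)
    (hxy : x ≠ y) : 1 / 2 ^ n ≤ |x - y| := by
  obtain ⟨a, ha, rfl⟩ := mem_nodes_one_iff.1 hx
  obtain ⟨b, hb, rfl⟩ := mem_nodes_one_iff.1 hy
  have hN : (0 : ℝ) < 2 ^ n := by positivity
  have hab : (a : ℤ) - b ≠ 0 := by
    intro h
    apply hxy
    rw [show a = b by omega]
  rw [← sub_div, abs_div, abs_of_pos hN]
  have : (1 : ℝ) ≤ |(a : ℝ) - b| := by exact_mod_cast Int.one_le_abs hab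
  gcongr

/-- Points in the cells of the ends of a wire are at most twice as far apart as these ends. -/
theorem IsWire.abs_sub_le {i n : ℕ} (hi : 1 ≤ i) {x y : ℝ} (h : IsWire i n x y) {z w : ℝ}
    (hz : z ∈ cell i n x) (hw : w ∈ cell i n y) : |z - w| ≤ 2 * |x - y| := by
  rcases hi.eq_or_lt with rfl | hi2
  · obtain ⟨hx, hy, hne⟩ := isWire_one_iff.1 h
    have h1 := abs_sub_le_half_of_mem_cell_one hz
    have h2 := abs_sub_le_half_of_mem_cell_one hw
    have h3 := level_le_abs_sub hx hy hne
    -- The two half cells together have length one mesh, which is at most `|x - y|`: hence the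
    -- factor 2.
    have h4 : (1 : ℝ) / 2 / 2 ^ n + 1 / 2 / 2 ^ n = 1 / 2 ^ n := by ring
    calc |z - w| = |(z - x) + (x - y) - (w - y)| := by ring_nf
      _ ≤ |z - x| + |x - y| + |w - y| := by
        exact (abs_sub _ _).trans (by gcongr; exact abs_add_le _ _)
      _ ≤ 2 * |x - y| := by linarith
  -- For `i ≥ 2` both cells extend from their nodes towards each other, so distances can only
  -- decrease.
  · have h2 := inv_le_one_sub_inv hi2
    rcases h.node_sides hi2 with ⟨hc, h3, hc', h4⟩ | ⟨hc', h3, hc, h4⟩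
    · rw [hc] at hz
      rw [hc'] at hw
      obtain ⟨hz1, hz2⟩ := hz
      obtain ⟨hw1, hw2⟩ := hw
      rw [abs_of_nonpos (by linarith), abs_of_nonpos (by linarith)]
      linarith
    · rw [hc] at hz
      rw [hc'] at hw
      obtain ⟨hz1, hz2⟩ := hz
      obtain ⟨hw1, hw2⟩ := hw
      rw [abs_of_nonneg (by linarith), abs_of_nonneg (by linarith)]
      linarith

theorem IsWire.mem_linked {i n : ℕ} (hi : 1 ≤ i) {x y : ℝ} (h : IsWire i n x y) {z w : ℝ}
    (hz : z ∈ cell i n x) (hw : w ∈ cell i n y) : (z, w) ∈ linked i := by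
  rcases hi.eq_or_lt with rfl | hi2
  · simp [linked]
  · rw [linked, if_neg (by omega)]
    rcases h.node_sides hi2 with ⟨hc, h3, hc', h4⟩ | ⟨hc', h3, hc, h4⟩
    · rw [hc] at hz
      rw [hc'] at hw
      exact .inl ⟨hz.2.trans_le h3, h4.trans_lt hw.1⟩
    · rw [hc] at hz
      rw [hc'] at hw
      exact .inr ⟨h4.trans_lt hz.1, hw.2.trans_le h3⟩

/-- The converse of `IsWire.mem_linked`. It ensures that a linked pair off the diagonal is seen by a
wire at every fine enough level, as the Fatou argument needs. -/
theorem isWire_of_mem_linked {i n : ℕ} (hi : 1 ≤ i) {x y : ℝ} (hx : x ∈ nodes i n)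
    (hy : y ∈ nodes i n) (hne : x ≠ y) {z w : ℝ} (hz : z ∈ cell i n x) (hw : w ∈ cell i n y)
    (hzw : (z, w) ∈ linked i) : IsWire i n x y := by
  rcases hi.eq_or_lt with rfl | hi2
  · exact isWire_one_iff.2 ⟨hx, hy, hne⟩
  · rw [linked, if_neg (by omega)] at hzw
    have h2 := inv_le_one_sub_inv hi2
    have hlt : ∀ a b : ℕ, a < 2 ^ n → b < 2 ^ n → a + b < 2 ^ n * i := by
      intro a b ha hb
      have := Nat.mul_le_mul_left (2 ^ n) hi2
      omega
    rcases node_cases hi2 hx with ⟨a, ha, hxa, h1, h0, hc⟩ | ⟨a, ha, hxa, h1, h0, hc⟩ <;>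
    rcases node_cases hi2 hy with ⟨b, hb, hyb, h1', h0', hc'⟩ | ⟨b, hb, hyb, h1', h0', hc'⟩ <;>
    rw [hc] at hz <;> rw [hc'] at hw <;> obtain ⟨hz1, hz2⟩ := hz <;> obtain ⟨hw1, hw2⟩ := hw
    · rcases hzw with ⟨h3, h4⟩ | ⟨h3, h4⟩ <;> simp only at h3 h4 <;> linarith
    · exact (isWire_iff hi).2 ⟨a, b, ha, hb, hlt a b ha hb, .inl ⟨hxa, hyb⟩⟩
    · exact (isWire_iff hi).2 ⟨b, a, hb, ha, hlt b a hb ha, .inr ⟨hxa, hyb⟩⟩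
    · rcases hzw with ⟨h3, h4⟩ | ⟨h3, h4⟩ <;> simp only at h3 h4 <;> linarith

/-! ### Extension, averaging and the `L²` norm -/

theorem enorm_sq_eq_ofReal (a : ℝ) : ‖a‖ₑ ^ 2 = ENNReal.ofReal (a ^ 2) := by
  rw [← ofReal_norm, ← ENNReal.ofReal_pow (norm_nonneg a), Real.norm_eq_abs, sq_abs]

theorem eLpNorm_two_sq {α : Type*} [MeasurableSpace α] (f : α → ℝ) (μ : Measure α) :
    eLpNorm f 2 μ ^ 2 = ∫⁻ z, ENNReal.ofReal (f z ^ 2) ∂μ := by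
  have h := eLpNorm_nnreal_pow_eq_lintegral (μ := μ) (f := f) (p := 2) (by norm_num)
  simp only [NNReal.coe_ofNat, ENNReal.rpow_ofNat, ENNReal.coe_ofNat] at h
  rw [h]
  simp_rw [enorm_sq_eq_ofReal]

theorem eLpNorm_two_le_iff {α : Type*} [MeasurableSpace α] (f g : α → ℝ) (μ : Measure α) :
    eLpNorm f 2 μ ≤ eLpNorm g 2 μ ↔
      ∫⁻ z, ENNReal.ofReal (f z ^ 2) ∂μ ≤ ∫⁻ z, ENNReal.ofReal (g z ^ 2) ∂μ := by
  rw [← eLpNorm_two_sq, ← eLpNorm_two_sq]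
  exact (ENNReal.pow_le_pow_left_iff two_ne_zero).symm

/-- Jensen's inequality for the square. -/
theorem ofReal_average_sq_mul_le {α : Type*} [MeasurableSpace α] {ν : Measure α}
    [IsFiniteMeasure ν] {f : α → ℝ} (hf : MemLp f 2 ν) :
    ENNReal.ofReal ((⨍ z, f z ∂ν) ^ 2) * ν Set.univ ≤ ∫⁻ z, ENNReal.ofReal (f z ^ 2) ∂ν := by
  rcases eq_zero_or_neZero ν with rfl | hν
  · simp
  have h1 : (⨍ z, f z ∂ν) ^ 2 ≤ ⨍ z, f z ^ 2 ∂ν :=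
    (Even.convexOn_pow (𝕜 := ℝ) even_two).map_average_le (by fun_prop) isClosed_univ (by simp)
      (hf.integrable one_le_two) hf.integrable_sq
  have hint : Integrable (fun z => f z ^ 2) ν := hf.integrable_sq
  rw [← ofReal_integral_eq_lintegral_ofReal hint (ae_of_all _ fun z => sq_nonneg _),
    ← ofReal_measureReal, ← ENNReal.ofReal_mul (sq_nonneg _)]
  apply ENNReal.ofReal_le_ofReal
  rw [average_eq, smul_eq_mul] at h1 ⊢
  rw [average_eq, smul_eq_mul] at h1
  have hpos : 0 < ν.real Set.univ := by
    rw [measureReal_def]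
    exact ENNReal.toReal_pos (NeZero.ne _) (measure_ne_top _ _)
  calc _ ≤ ((ν.real Set.univ)⁻¹ * ∫ z, f z ^ 2 ∂ν) * ν.real Set.univ := by gcongr
    _ = _ := by field_simp

section

variable {i n : ℕ}

theorem restrict_physicalMeasure_cell (hi : 1 ≤ i) {x : ℝ} (hx : x ∈ nodes i n) :
    (physicalMeasure i).restrict (cell i n x) = volume.restrict (cell i n x) :=
  Measure.restrict_restrict_of_subset (cell_subset hi hx)

theorem physicalMeasure_cell (hi : 1 ≤ i) {x : ℝ} (hx : x ∈ nodes i n) :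
    physicalMeasure i (cell i n x) = ENNReal.ofReal (mass i n x) := by
  have h := restrict_physicalMeasure_cell hi hx
  have h1 : physicalMeasure i (cell i n x) = volume (cell i n x) := by
    rw [← Measure.restrict_apply_univ, h, Measure.restrict_apply_univ]
  rw [mass, measureReal_def, ← h1, ENNReal.ofReal_toReal (measure_ne_top _ _)]

theorem physicalMeasure_iUnion_cell (hi : 1 ≤ i) (n : ℕ) :
    (⋃ x ∈ nodes i n, cell i n x) =ᵐ[physicalMeasure i] Set.univ := by
  rw [eventuallyEq_univ]
  filter_upwards [ae_mem_cell hi] with z hz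
  obtain ⟨x, hx, h⟩ := hz n
  exact Set.mem_biUnion hx h

theorem pairwiseDisjoint_cell (hi : 1 ≤ i) (n : ℕ) :
    (nodes i n : Set ℝ).PairwiseDisjoint (cell i n) :=
  fun _ hx _ hy hxy => cell_disjoint hi hx hy hxy

theorem lintegral_physicalMeasure_eq_sum (hi : 1 ≤ i) (n : ℕ) (F : ℝ → ℝ≥0∞) :
    ∫⁻ z, F z ∂physicalMeasure i = ∑ x : nodes i n, ∫⁻ z in cell i n x, F z ∂physicalMeasure i := by
  rw [Finset.sum_coe_sort (nodes i n) (fun x => ∫⁻ z in cell i n x, F z ∂physicalMeasure i),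
    ← lintegral_biUnion_finset (pairwiseDisjoint_cell hi n) (fun x _ => measurableSet_cell i n x),
    Measure.restrict_congr_set (physicalMeasure_iUnion_cell hi n), Measure.restrict_univ]

theorem extend_eq (hi : 1 ≤ i) (u : nodes i n → ℝ) (x : nodes i n) {z : ℝ}
    (hz : z ∈ cell i n x) : extend i n u z = u x := by
  rw [extend, Finset.sum_eq_single x, Set.indicator_of_mem hz]
  · intro y _ hyx
    rw [Set.indicator_of_notMem]
    exact Set.disjoint_left.1 (cell_disjoint hi x.2 y.2 fun h => hyx (Subtype.ext h.symm)) hz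
  · simp

theorem measurable_extend (u : nodes i n → ℝ) : Measurable (extend i n u) :=
  Finset.measurable_fun_sum _ fun y _ =>
    measurable_const.indicator (measurableSet_cell i n y)

theorem extend_sub (u v : nodes i n → ℝ) (z : ℝ) :
    extend i n (fun x => u x - v x) z = extend i n u z - extend i n v z := by
  simp only [extend, ← Finset.sum_sub_distrib]
  refine Finset.sum_congr rfl fun x _ => ?_
  by_cases h : z ∈ cell i n x <;> simp [h]

/-- The norm of `ℓ²(V_i^{(n)}, μ_i^{(n)})`. -/
noncomputable def levelNorm (i n : ℕ) (u : nodes i n → ℝ) : ℝ :=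
  √(∑ x : nodes i n, u x ^ 2 * mass i n x)

theorem mass_nonneg (i n : ℕ) (x : ℝ) : 0 ≤ mass i n x := measureReal_nonneg

theorem lintegral_extend_sq (hi : 1 ≤ i) (u : nodes i n → ℝ) :
    ∫⁻ z, ENNReal.ofReal (extend i n u z ^ 2) ∂physicalMeasure i =
      ENNReal.ofReal (∑ x : nodes i n, u x ^ 2 * mass i n x) := by
  rw [lintegral_physicalMeasure_eq_sum hi n, ENNReal.ofReal_sum_of_nonneg
    fun x _ => mul_nonneg (sq_nonneg _) (mass_nonneg _ _ _)]
  refine Finset.sum_congr rfl fun x _ => ?_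
  rw [ENNReal.ofReal_mul (sq_nonneg _), ← physicalMeasure_cell hi x.2, ← setLIntegral_const]
  refine setLIntegral_congr_fun (measurableSet_cell i n x) fun z hz => ?_
  simp only [extend_eq hi u x hz]

theorem eLpNorm_extend (hi : 1 ≤ i) (u : nodes i n → ℝ) :
    eLpNorm (extend i n u) 2 (physicalMeasure i) = ENNReal.ofReal (levelNorm i n u) := by
  have h : eLpNorm (extend i n u) 2 (physicalMeasure i) ^ 2 =
      ENNReal.ofReal (levelNorm i n u) ^ 2 := by
    rw [eLpNorm_two_sq, lintegral_extend_sq hi, levelNorm,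
      ← ENNReal.ofReal_pow (Real.sqrt_nonneg _), Real.sq_sqrt]
    exact Finset.sum_nonneg fun x _ => mul_nonneg (sq_nonneg _) (mass_nonneg _ _ _)
  exact (ENNReal.pow_right_strictMono two_ne_zero).injective h

theorem average_eq_setAverage (hi : 1 ≤ i) (v : ℝ → ℝ) (x : nodes i n) :
    average i n v x = ⨍ z in cell i n x, v z ∂physicalMeasure i := by
  rw [average, ← restrict_physicalMeasure_cell hi x.2]

/-- Jensen's inequality on each cell. The resulting `L²` contraction reduces convergence of averages
to a dense class. -/
theorem eLpNorm_extend_average_le (hi : 1 ≤ i) {v : ℝ → ℝ} (hv : MemLp v 2 (physicalMeasure i)) :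
    eLpNorm (extend i n (average i n v)) 2 (physicalMeasure i) ≤
      eLpNorm v 2 (physicalMeasure i) := by
  rw [eLpNorm_two_le_iff, lintegral_physicalMeasure_eq_sum hi n,
    lintegral_physicalMeasure_eq_sum hi n (fun z => ENNReal.ofReal (v z ^ 2))]
  refine Finset.sum_le_sum fun x _ => ?_
  have h := ofReal_average_sq_mul_le (hv.restrict (cell i n x))
  rw [Measure.restrict_apply_univ, ← setLIntegral_const, ← average_eq_setAverage hi] at h
  refine le_trans (le_of_eq ?_) h
  refine setLIntegral_congr_fun (measurableSet_cell i n x) fun z hz => ?_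
  simp only [extend_eq hi _ x hz]

theorem average_sub (hi : 1 ≤ i) {u v : ℝ → ℝ} (hu : MemLp u 2 (physicalMeasure i))
    (hv : MemLp v 2 (physicalMeasure i)) (x : nodes i n) :
    average i n (u - v) x = average i n u x - average i n v x := by
  simp only [average_eq_setAverage hi, MeasureTheory.average_eq, Pi.sub_apply]
  rw [integral_sub ((hu.restrict _).integrable one_le_two) ((hv.restrict _).integrable one_le_two),
    smul_sub]

/-! ### Strong convergence of restrictions and averages. -/

theorem tendsto_one_div_two_pow : Tendsto (fun n : ℕ => (1 : ℝ) / 2 ^ n) atTop (𝓝 0) := by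
  simpa using tendsto_pow_atTop_nhds_zero_of_lt_one (r := (1 / 2 : ℝ)) (by norm_num) (by norm_num)

/-- Cells shrink uniformly and `f` is uniformly continuous on a compact set, so the extensions
converge uniformly almost everywhere; the measure is finite. -/
theorem stronglyConverges_of_uniform (hi : 1 ≤ i) {f : ℝ → ℝ} (hf : ContinuousOn f (physicalSpace i))
    (w : (n : ℕ) → nodes i n → ℝ)
    (hw : ∀ ε > 0, ∀ᶠ n in atTop, ∀ x : nodes i n, |w n x - f x| ≤ ε) :
    StronglyConverges i w f := by
  have huc := (isCompact_physicalSpace i).uniformContinuousOn_of_continuous hf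
  rw [Metric.uniformContinuousOn_iff] at huc
  set M := (physicalMeasure i) Set.univ ^ (2 : ℝ≥0∞).toReal⁻¹ with hM
  have hMtop : M ≠ ∞ := ENNReal.rpow_ne_top_of_nonneg (by simp) (measure_ne_top _ _)
  have key : ∀ ε > 0, ∀ᶠ n in atTop,
      eLpNorm (fun x => extend i n (w n) x - f x) 2 (physicalMeasure i) ≤ M * ENNReal.ofReal ε := by
    intro ε hε
    obtain ⟨δ, hδ, h⟩ := huc (ε / 2) (half_pos hε)
    filter_upwards [hw (ε / 2) (half_pos hε),
      tendsto_one_div_two_pow.eventually (gt_mem_nhds hδ)] with n hn hn'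
    refine eLpNorm_le_of_ae_bound ?_
    filter_upwards [ae_mem_cell hi] with z hz
    obtain ⟨x, hx, hzx⟩ := hz n
    rw [extend_eq hi (w n) ⟨x, hx⟩ hzx, Real.norm_eq_abs]
    have h1 := h x (node_mem_physicalSpace hi hx) z (cell_subset hi hx hzx) (by
      rw [dist_comm, Real.dist_eq]
      exact (abs_sub_le_of_mem_cell hi hzx).trans_lt hn')
    rw [Real.dist_eq] at h1
    have h2 := hn ⟨x, hx⟩
    calc _ ≤ |w n ⟨x, hx⟩ - f x| + |f x - f z| := abs_sub_le _ _ _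
      _ ≤ ε := by linarith
  rw [StronglyConverges, ENNReal.tendsto_nhds_zero]
  intro η hη
  rcases eq_or_ne η ∞ with rfl | hη'
  · simp
  have h0 : Tendsto (fun ε : ℝ => M * ENNReal.ofReal ε) (𝓝[>] 0) (𝓝 0) := by
    have h1 : Tendsto (fun ε : ℝ => M * ENNReal.ofReal ε) (𝓝 0) (𝓝 (M * ENNReal.ofReal 0)) :=
      ENNReal.Tendsto.const_mul (ENNReal.continuous_ofReal.tendsto 0) (.inr hMtop)
    simp only [ENNReal.ofReal_zero, mul_zero] at h1
    exact h1.mono_left nhdsWithin_le_nhds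
  obtain ⟨ε, hε1, hε2⟩ := ((h0.eventually (gt_mem_nhds hη)).and self_mem_nhdsWithin).exists
  exact (key ε hε2).mono fun n hn => hn.trans hε1.le

theorem stronglyConverges_restrictNodes (hi : 1 ≤ i) {f : ℝ → ℝ}
    (hf : ContinuousOn f (physicalSpace i)) :
    StronglyConverges i (fun n => restrictNodes i n f) f :=
  stronglyConverges_of_uniform hi hf _ fun ε hε => .of_forall fun n x => by
    simpa [restrictNodes] using hε.le

theorem memLp_of_continuousOn {f : ℝ → ℝ} (hf : ContinuousOn f (physicalSpace i)) :
    MemLp f 2 (physicalMeasure i) := by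
  obtain ⟨C, hC⟩ := (isCompact_physicalSpace i).exists_bound_of_continuousOn hf
  refine MemLp.of_bound (hf.aestronglyMeasurable (measurableSet_physicalSpace i)) C ?_
  filter_upwards [ae_restrict_mem (measurableSet_physicalSpace i)] with z hz
  exact hC z hz

theorem stronglyConverges_average_of_continuousOn (hi : 1 ≤ i) {f : ℝ → ℝ}
    (hf : ContinuousOn f (physicalSpace i)) :
    StronglyConverges i (fun n => average i n f) f := by
  refine stronglyConverges_of_uniform hi hf _ fun ε hε => ?_
  have huc := (isCompact_physicalSpace i).uniformContinuousOn_of_continuous hf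
  rw [Metric.uniformContinuousOn_iff] at huc
  obtain ⟨δ, hδ, h⟩ := huc ε hε
  filter_upwards [tendsto_one_div_two_pow.eventually (gt_mem_nhds hδ)] with n hn x
  have hmem := memLp_of_continuousOn hf
  have hcell : (physicalMeasure i) (cell i n x) ≠ 0 := by
    rw [physicalMeasure_cell hi x.2]
    simpa using mass_pos hi x.2
  -- An average of values in a closed convex set, here a ball around `f x`, stays in it.
  have h1 : average i n f x ∈ Metric.closedBall (f x) ε := by
    rw [average_eq_setAverage hi]
    refine (convex_closedBall _ _).set_average_mem Metric.isClosed_closedBall hcell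
      (measure_ne_top _ _) ?_ ((hmem.restrict _).integrable one_le_two)
    filter_upwards [ae_restrict_mem (measurableSet_cell i n x)] with z hz
    refine (h z (cell_subset hi x.2 hz) x (node_mem_physicalSpace hi x.2) ?_).le
    rw [Real.dist_eq]
    exact (abs_sub_le_of_mem_cell hi hz).trans_lt hn
  simpa [Real.dist_eq] using h1

theorem exists_lipschitz_approx {u : ℝ → ℝ} (hu : MemLp u 2 (physicalMeasure i)) {ε : ℝ}
    (hε : 0 < ε) : ∃ f : ℝ → ℝ, (∃ K : ℝ≥0, LipschitzWith K f) ∧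
      eLpNorm (u - f) 2 (physicalMeasure i) ≤ ENNReal.ofReal ε := by
  obtain ⟨g, hg1, hg2, hg3⟩ := hu.exist_eLpNorm_sub_le (by norm_num) one_le_two hε
  exact ⟨g, ContDiff.lipschitzWith_of_hasCompactSupport hg1 hg2 (by simp), hg3⟩

/-- The averages of an `L²` function converge strongly to it. -/
theorem stronglyConverges_average (hi : 1 ≤ i) {u : ℝ → ℝ} (hu : MemLp u 2 (physicalMeasure i)) :
    StronglyConverges i (fun n => average i n u) u := by
  rw [StronglyConverges, ENNReal.tendsto_nhds_zero]
  intro η hη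
  obtain ⟨ε, hε, hεη⟩ : ∃ ε : ℝ, 0 < ε ∧ ENNReal.ofReal (3 * ε) ≤ η := by
    rcases eq_or_ne η ∞ with rfl | h
    · exact ⟨1, one_pos, le_top⟩
    · refine ⟨η.toReal / 3, div_pos (ENNReal.toReal_pos hη.ne' h) (by norm_num), ?_⟩
      rw [mul_div_cancel₀ _ (by norm_num : (3 : ℝ) ≠ 0), ENNReal.ofReal_toReal h]
  obtain ⟨f, ⟨K, hK⟩, hf⟩ := exists_lipschitz_approx hu hε
  have hfc : ContinuousOn f (physicalSpace i) := hK.continuous.continuousOn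
  have hfm := memLp_of_continuousOn hfc
  have h1 := stronglyConverges_average_of_continuousOn hi hfc
  rw [StronglyConverges, ENNReal.tendsto_nhds_zero] at h1
  filter_upwards [h1 (ENNReal.ofReal ε) (by simpa using hε)] with n hn
  -- The three terms are controlled by contraction, by the continuous case and by the choice of `f`;
  -- each costs `ε`.
  have e : (fun x => extend i n (average i n u) x - u x) =
      (extend i n (average i n (u - f)) + (fun x => extend i n (average i n f) x - f x)) -
        (u - f) := by
    have : average i n (u - f) = fun x => average i n u x - average i n f x :=
      funext fun x => average_sub hi hu hfm x
    funext z
    simp only [Pi.add_apply, Pi.sub_apply, this, extend_sub]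
    ring
  have m1 := (measurable_extend (average i n (u - f))).aestronglyMeasurable
    (μ := physicalMeasure i)
  have m2 : AEStronglyMeasurable (fun x => extend i n (average i n f) x - f x)
    (physicalMeasure i) := (measurable_extend _).aestronglyMeasurable.sub hfm.1
  rw [e]
  calc _ ≤ _ := eLpNorm_sub_le (m1.add m2) (hu.1.sub hfm.1) one_le_two
    _ ≤ _ := add_le_add_left (eLpNorm_add_le m1 m2 one_le_two) _
    _ ≤ ENNReal.ofReal ε + ENNReal.ofReal ε + ENNReal.ofReal ε :=
      add_le_add (add_le_add ((eLpNorm_extend_average_le hi (hu.sub hfm)).trans hf) hn) hf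
    _ = ENNReal.ofReal (3 * ε) := by
      rw [← ENNReal.ofReal_add hε.le hε.le, ← ENNReal.ofReal_add (by positivity) hε.le]
      ring_nf
    _ ≤ η := hεη

end

/-! ### Cutoffs away from the diagonal -/

/-- Truncation to the unit interval. -/
def clamp (t : ℝ) : ℝ := max 0 (min 1 t)

theorem clamp_mono : Monotone clamp := fun _ _ h => max_le_max le_rfl (min_le_min le_rfl h)

theorem clamp_of_nonpos {t : ℝ} (h : t ≤ 0) : clamp t = 0 :=
  max_eq_left ((min_le_right _ _).trans h)

theorem clamp_of_one_le {t : ℝ} (h : 1 ≤ t) : clamp t = 1 := by simp [clamp, h]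

theorem clamp_le_one (t : ℝ) : clamp t ≤ 1 := max_le zero_le_one (min_le_left _ _)

theorem clamp_nonneg (t : ℝ) : 0 ≤ clamp t := le_max_left _ _

theorem lipschitzWith_clamp : LipschitzWith 1 clamp :=
  (LipschitzWith.id.const_min 1).const_max 0

/-- The hat function with peak at `k / m` and support of radius `1 / m`. -/
def hat (m k : ℕ) (x : ℝ) : ℝ := clamp (m * x - k + 1) - clamp (m * x - k)

theorem hat_nonneg (m k : ℕ) (x : ℝ) : 0 ≤ hat m k x :=
  sub_nonneg.2 (clamp_mono (by linarith))

theorem abs_sub_lt_of_hat_ne_zero {m k : ℕ} {x : ℝ} (h : hat m k x ≠ 0) : |m * x - k| < 1 := by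
  contrapose! h
  rcases le_abs.1 h with h | h
  · rw [hat, clamp_of_one_le h, clamp_of_one_le (by linarith), sub_self]
  · rw [hat, clamp_of_nonpos (by linarith), clamp_of_nonpos (by linarith), sub_self]

/-- The sum telescopes from `clamp (m * x + 1) = 1` to `clamp (m * x - m) = 0`. -/
theorem sum_hat {m : ℕ} {x : ℝ} (hx : x ∈ Set.Icc (0 : ℝ) 1) :
    ∑ k ∈ Finset.range (m + 1), hat m k x = 1 := by
  have h := Finset.sum_range_sub' (fun k : ℕ => clamp (m * x - k + 1)) (m + 1)
  have e : ∀ k : ℕ, hat m k x =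
      clamp (m * x - k + 1) - clamp (m * x - (k + 1 : ℕ) + 1) := by
    intro k
    rw [hat]
    congr 2
    push_cast
    ring
  have hm : (0 : ℝ) ≤ m := Nat.cast_nonneg m
  simp only [e]
  rw [h, clamp_of_one_le, clamp_of_nonpos, sub_zero]
  · push_cast
    nlinarith [hx.2]
  · push_cast
    nlinarith [hx.1]

theorem exists_lipschitzWith_hat (m k : ℕ) : ∃ K : ℝ≥0, LipschitzWith K (hat m k) := by
  have h1 : LipschitzWith m (fun x : ℝ => m * x - k) := by
    refine LipschitzWith.of_dist_le_mul fun x y => ?_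
    rw [Real.dist_eq, Real.dist_eq, sub_sub_sub_cancel_right, ← mul_sub, abs_mul]
    simp
  have h2 : LipschitzWith m (fun x : ℝ => m * x - k + 1) := by
    refine LipschitzWith.of_dist_le_mul fun x y => ?_
    rw [Real.dist_eq, Real.dist_eq, add_sub_add_right_eq_sub, sub_sub_sub_cancel_right, ← mul_sub,
      abs_mul]
    simp
  exact ⟨_, (lipschitzWith_clamp.comp h2).sub (lipschitzWith_clamp.comp h1)⟩

/-- Pairs of indices of hat functions whose supports are separated. -/
def separatedPairs (m : ℕ) : Finset (ℕ × ℕ) :=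
  (Finset.range (m + 1) ×ˢ Finset.range (m + 1)).filter fun p => p.1 + 3 ≤ p.2 ∨ p.2 + 3 ≤ p.1

/-- A cutoff function that vanishes near the diagonal and is `1` away from it. -/
def cutoff (m : ℕ) (x y : ℝ) : ℝ := ∑ p ∈ separatedPairs m, hat m p.1 x * hat m p.2 y

/-- In the variable `m * x` the supports have radius 1 and centres at least 3 apart. Disjointness is
what polarisation requires. -/
theorem hat_mul_hat_eq_zero {m : ℕ} {p : ℕ × ℕ} (hp : p ∈ separatedPairs m) (x : ℝ) :
    hat m p.1 x * hat m p.2 x = 0 := by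
  by_contra h
  have h1 := abs_lt.1 (abs_sub_lt_of_hat_ne_zero (left_ne_zero_of_mul h))
  have h2 := abs_lt.1 (abs_sub_lt_of_hat_ne_zero (right_ne_zero_of_mul h))
  rcases (Finset.mem_filter.1 hp).2 with h3 | h3
  · have : (p.1 : ℝ) + 3 ≤ p.2 := by exact_mod_cast h3
    linarith [h1.1, h1.2, h2.1, h2.2]
  · have : (p.2 : ℝ) + 3 ≤ p.1 := by exact_mod_cast h3
    linarith [h1.1, h1.2, h2.1, h2.2]

theorem cutoff_nonneg (m : ℕ) (x y : ℝ) : 0 ≤ cutoff m x y :=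
  Finset.sum_nonneg fun _ _ => mul_nonneg (hat_nonneg _ _ _) (hat_nonneg _ _ _)

theorem sum_hat_mul_hat {m : ℕ} {x y : ℝ} (hx : x ∈ Set.Icc (0 : ℝ) 1)
    (hy : y ∈ Set.Icc (0 : ℝ) 1) :
    ∑ p ∈ Finset.range (m + 1) ×ˢ Finset.range (m + 1), hat m p.1 x * hat m p.2 y = 1 := by
  have h := Finset.sum_mul_sum (Finset.range (m + 1)) (Finset.range (m + 1))
    (fun k => hat m k x) (fun k => hat m k y)
  rw [sum_hat hx, sum_hat hy, one_mul] at h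
  rw [Finset.sum_product, h]

theorem cutoff_le_one {m : ℕ} {x y : ℝ} (hx : x ∈ Set.Icc (0 : ℝ) 1)
    (hy : y ∈ Set.Icc (0 : ℝ) 1) : cutoff m x y ≤ 1 := by
  rw [← sum_hat_mul_hat (m := m) hx hy]
  exact Finset.sum_le_sum_of_subset_of_nonneg (Finset.filter_subset _ _) fun _ _ _ =>
    mul_nonneg (hat_nonneg _ _ _) (hat_nonneg _ _ _)

/-- The threshold is `5 = 3 + 1 + 1`: two hats that do not vanish at `x` and `y` then have indices
at least 3 apart, so no term of the full partition of unity is lost. -/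
theorem cutoff_eq_one {m : ℕ} {x y : ℝ} (hx : x ∈ Set.Icc (0 : ℝ) 1)
    (hy : y ∈ Set.Icc (0 : ℝ) 1) (h : 5 ≤ m * |x - y|) : cutoff m x y = 1 := by
  rw [← sum_hat_mul_hat (m := m) hx hy]
  refine Finset.sum_filter_of_ne fun p _ hp => ?_
  have h1 := abs_lt.1 (abs_sub_lt_of_hat_ne_zero (left_ne_zero_of_mul hp))
  have h2 := abs_lt.1 (abs_sub_lt_of_hat_ne_zero (right_ne_zero_of_mul hp))
  have e : (m : ℝ) * |x - y| = |m * x - m * y| := by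
    rw [← mul_sub, abs_mul, Nat.abs_cast]
  rw [e] at h
  rcases le_abs.1 h with h | h
  · right
    have : (p.2 : ℝ) + 3 ≤ p.1 := by linarith [h1.1, h1.2, h2.1, h2.2]
    exact_mod_cast this
  · left
    have : (p.1 : ℝ) + 3 ≤ p.2 := by linarith [h1.1, h1.2, h2.1, h2.2]
    exact_mod_cast this

theorem one_le_of_cutoff_ne_zero {m : ℕ} {x y : ℝ} (h : cutoff m x y ≠ 0) :
    1 ≤ m * |x - y| := by
  obtain ⟨p, hp, hne⟩ := Finset.exists_ne_zero_of_sum_ne_zero h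
  have h1 := abs_lt.1 (abs_sub_lt_of_hat_ne_zero (left_ne_zero_of_mul hne))
  have h2 := abs_lt.1 (abs_sub_lt_of_hat_ne_zero (right_ne_zero_of_mul hne))
  have e : (m : ℝ) * |x - y| = |m * x - m * y| := by
    rw [← mul_sub, abs_mul, Nat.abs_cast]
  rw [e]
  rcases (Finset.mem_filter.1 hp).2 with h3 | h3
  · have : (p.1 : ℝ) + 3 ≤ p.2 := by exact_mod_cast h3
    exact le_abs.2 (.inr (by linarith [h1.1, h1.2, h2.1, h2.2]))
  · have : (p.2 : ℝ) + 3 ≤ p.1 := by exact_mod_cast h3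
    exact le_abs.2 (.inl (by linarith [h1.1, h1.2, h2.1, h2.2]))

/-! ### Convergence of the truncated energies of Lipschitz functions -/

/-- Lipschitz continuity on the physical space with some constant. -/
def IsLipschitz (i : ℕ) (f : ℝ → ℝ) : Prop := ∃ K : ℝ≥0, LipschitzOnWith K f (physicalSpace i)

section

variable {i : ℕ}

theorem IsLipschitz.continuousOn {f : ℝ → ℝ} (hf : IsLipschitz i f) :
    ContinuousOn f (physicalSpace i) := hf.choose_spec.continuousOn

theorem IsLipschitz.add {f g : ℝ → ℝ} (hf : IsLipschitz i f) (hg : IsLipschitz i g) :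
    IsLipschitz i (f + g) := by
  obtain ⟨K, hK⟩ := hf
  obtain ⟨L, hL⟩ := hg
  exact ⟨K + L, hK.add hL⟩

theorem IsLipschitz.mul {f g : ℝ → ℝ} (hf : IsLipschitz i f) (hg : IsLipschitz i g) :
    IsLipschitz i (f * g) := by
  obtain ⟨A, hA⟩ := (isCompact_physicalSpace i).exists_bound_of_continuousOn hf.continuousOn
  obtain ⟨B, hB⟩ := (isCompact_physicalSpace i).exists_bound_of_continuousOn hg.continuousOn
  obtain ⟨K, hK⟩ := hf
  obtain ⟨L, hL⟩ := hg
  refine ⟨A.toNNReal * L + B.toNNReal * K, LipschitzOnWith.of_dist_le_mul fun x hx y hy => ?_⟩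
  have h1 := hK.dist_le_mul x hx y hy
  have h2 := hL.dist_le_mul x hx y hy
  have h3 := (hA x hx).trans (Real.le_coe_toNNReal A)
  have h4 := (hB y hy).trans (Real.le_coe_toNNReal B)
  rw [Real.dist_eq] at h1 h2 ⊢
  rw [Real.norm_eq_abs] at h3 h4
  have e : (f * g) x - (f * g) y = f x * (g x - g y) + g y * (f x - f y) := by
    simp only [Pi.mul_apply]; ring
  rw [e]
  push_cast
  calc _ ≤ |f x| * |g x - g y| + |g y| * |f x - f y| := by
        rw [← abs_mul, ← abs_mul]; exact abs_add_le _ _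
    _ ≤ A.toNNReal * (L * dist x y) + B.toNNReal * (K * dist x y) := by gcongr
    _ = _ := by ring

theorem isLipschitz_hat (i m k : ℕ) : IsLipschitz i (hat m k) := by
  obtain ⟨K, hK⟩ := exists_lipschitzWith_hat m k
  exact ⟨K, hK.lipschitzOnWith⟩

/-- The weight of the pair `x, y` in the discrete energy. -/
noncomputable def edgeWeight (r : ℕ → ℕ → ℝ) (i n : ℕ) (x y : ℝ) : ℝ :=
  jumpKernel r i n x y * mass i n x * mass i n y

theorem edgeWeight_comm (r : ℕ → ℕ → ℝ) (i n : ℕ) (x y : ℝ) :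
    edgeWeight r i n x y = edgeWeight r i n y x := by
  have h : conductance r i n x y = conductance r i n y x := by
    refine Finset.sum_congr (Finset.ext fun σ => ?_) fun _ _ => rfl
    simp only [Finset.mem_filter]
    unfold Joins
    tauto
  rw [edgeWeight, edgeWeight, jumpKernel, jumpKernel, h, mul_comm (mass i n x)]
  ring

open Classical in
theorem edgeWeight_of_not_isWire (r : ℕ → ℕ → ℝ) {n : ℕ} {x y : ℝ} (h : ¬ IsWire i n x y) :
    edgeWeight r i n x y = 0 := by
  have : conductance r i n x y = 0 := by
    refine Finset.sum_eq_zero fun σ hσ => absurd ?_ h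
    rw [Finset.mem_filter] at hσ
    exact ⟨σ, hσ.1, hσ.2⟩
  simp [edgeWeight, jumpKernel, this]

theorem discreteEnergy_eq (r : ℕ → ℕ → ℝ) (i n : ℕ) (u : nodes i n → ℝ) :
    discreteEnergy r i n u =
      ∑ x : nodes i n, ∑ y : nodes i n, (u x - u y) ^ 2 * edgeWeight r i n x y := by
  simp only [discreteEnergy, edgeWeight, mul_assoc]

/-- The pairing of two functions through the edge weights. -/
noncomputable def pairing (r : ℕ → ℕ → ℝ) (i n : ℕ) (f g : ℝ → ℝ) : ℝ :=
  ∑ x : nodes i n, ∑ y : nodes i n, f x * g y * edgeWeight r i n x y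

theorem pairing_comm (r : ℕ → ℕ → ℝ) (i n : ℕ) (f g : ℝ → ℝ) :
    pairing r i n f g = pairing r i n g f := by
  rw [pairing, Finset.sum_comm]
  refine Finset.sum_congr rfl fun x _ => Finset.sum_congr rfl fun y _ => ?_
  rw [edgeWeight_comm r i n y x]
  ring

/-- Since `f * g = 0`, the cross term `2 * (f x - f y) * (g x - g y)` reduces to `-2 * (f x * g y +
f y * g x)`, and both halves sum to the same pairing by symmetry of the weights. -/
theorem discreteEnergy_add (r : ℕ → ℕ → ℝ) (i n : ℕ) {f g : ℝ → ℝ} (h : ∀ x, f x * g x = 0) :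
    discreteEnergy r i n (restrictNodes i n (f + g)) =
      discreteEnergy r i n (restrictNodes i n f) + discreteEnergy r i n (restrictNodes i n g)
        - 4 * pairing r i n f g := by
  have e : 4 * pairing r i n f g = 2 * pairing r i n f g + 2 * pairing r i n g f := by
    rw [pairing_comm r i n g f]; ring
  rw [e]
  simp only [discreteEnergy_eq, pairing, Finset.mul_sum, ← Finset.sum_add_distrib,
    ← Finset.sum_sub_distrib]
  refine Finset.sum_congr rfl fun x _ => Finset.sum_congr rfl fun y _ => ?_
  simp only [restrictNodes, Pi.add_apply]
  linear_combination (2 * edgeWeight r i n x y) * (h x + h y)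

/-- This is where the assumed limits on Lipschitz functions are put to use. -/
theorem tendsto_pairing {r : ℕ → ℕ → ℝ}
    (hlim : ∀ f : ℝ → ℝ, IsLipschitz i f → ∃ L : ℝ, Tendsto (fun n =>
      discreteEnergy r i n (restrictNodes i n f)) atTop (𝓝 L))
    {f g : ℝ → ℝ} (hf : IsLipschitz i f) (hg : IsLipschitz i g) (h : ∀ x, f x * g x = 0) :
    ∃ L : ℝ, Tendsto (fun n => pairing r i n f g) atTop (𝓝 L) := by
  obtain ⟨A, hA⟩ := hlim f hf
  obtain ⟨B, hB⟩ := hlim g hg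
  obtain ⟨C, hC⟩ := hlim (f + g) (hf.add hg)
  refine ⟨(A + B - C) / 4, (((hA.add hB).sub hC).div_const 4).congr fun n => ?_⟩
  rw [discreteEnergy_add r i n h]
  ring

/-- The part of the discrete energy carried by pairs of distant nodes. -/
noncomputable def truncatedEnergy (r : ℕ → ℕ → ℝ) (i m n : ℕ) (u : nodes i n → ℝ) : ℝ :=
  ∑ x : nodes i n, ∑ y : nodes i n, cutoff m x y * ((u x - u y) ^ 2 * edgeWeight r i n x y)

/-- Expanding `(f x - f y) ^ 2` against a product of hats separates the variables, and each term
pairs two functions with disjoint supports. -/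
theorem truncatedEnergy_restrictNodes (r : ℕ → ℕ → ℝ) (i m n : ℕ) (f : ℝ → ℝ) :
    truncatedEnergy r i m n (restrictNodes i n f) = ∑ p ∈ separatedPairs m,
      (pairing r i n (hat m p.1 * (f * f)) (hat m p.2)
        - 2 * pairing r i n (hat m p.1 * f) (hat m p.2 * f)
        + pairing r i n (hat m p.1) (hat m p.2 * (f * f))) := by
  simp only [pairing, Finset.mul_sum, ← Finset.sum_add_distrib, ← Finset.sum_sub_distrib]
  rw [Finset.sum_comm, truncatedEnergy]
  refine Finset.sum_congr rfl fun x _ => ?_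
  rw [Finset.sum_comm]
  refine Finset.sum_congr rfl fun y _ => ?_
  rw [cutoff, Finset.sum_mul]
  refine Finset.sum_congr rfl fun p _ => ?_
  simp only [restrictNodes, Pi.mul_apply]
  ring

theorem tendsto_truncatedEnergy_restrictNodes {r : ℕ → ℕ → ℝ}
    (hlim : ∀ f : ℝ → ℝ, IsLipschitz i f → ∃ L : ℝ, Tendsto (fun n =>
      discreteEnergy r i n (restrictNodes i n f)) atTop (𝓝 L))
    (m : ℕ) {f : ℝ → ℝ} (hf : IsLipschitz i f) :
    ∃ L : ℝ, Tendsto (fun n => truncatedEnergy r i m n (restrictNodes i n f)) atTop (𝓝 L) := by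
  have key : ∀ p ∈ separatedPairs m, ∃ L : ℝ, Tendsto (fun n =>
      (pairing r i n (hat m p.1 * (f * f)) (hat m p.2)
        - 2 * pairing r i n (hat m p.1 * f) (hat m p.2 * f)
        + pairing r i n (hat m p.1) (hat m p.2 * (f * f)))) atTop (𝓝 L) := by
    intro p hp
    have h0 := hat_mul_hat_eq_zero hp
    have l1 := isLipschitz_hat i m p.1
    have l2 := isLipschitz_hat i m p.2
    obtain ⟨A, hA⟩ := tendsto_pairing hlim (l1.mul (hf.mul hf)) l2 fun x => by
      simp only [Pi.mul_apply]
      linear_combination (f x * f x) * h0 x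
    obtain ⟨B, hB⟩ := tendsto_pairing hlim (l1.mul hf) (l2.mul hf) fun x => by
      simp only [Pi.mul_apply]
      linear_combination (f x * f x) * h0 x
    obtain ⟨C, hC⟩ := tendsto_pairing hlim l1 (l2.mul (hf.mul hf)) fun x => by
      simp only [Pi.mul_apply]
      linear_combination (f x * f x) * h0 x
    exact ⟨_, (hA.sub (hB.const_mul 2)).add hC⟩
  choose! L hL using key
  refine ⟨∑ p ∈ separatedPairs m, L p, ?_⟩
  simp only [truncatedEnergy_restrictNodes]
  exact tendsto_finsetSum _ hL

end

/-! ### Convergence of the truncated energies along strongly convergent sequences -/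

section

variable {r : ℕ → ℕ → ℝ} {i : ℕ} {s Λ : ℝ}

/-- The upper half of the kernel bounds, with a given constant. -/
def UpperKernelBound (r : ℕ → ℕ → ℝ) (i : ℕ) (s Λ : ℝ) : Prop :=
  ∀ (n : ℕ) (x y : ℝ), IsWire i n x y →
    0 < jumpKernel r i n x y ∧ jumpKernel r i n x y ≤ Λ * |x - y| ^ (-(1 + 2 * s))

theorem edgeWeight_nonneg (hΛ : UpperKernelBound r i s Λ) (n : ℕ) (x y : ℝ) :
    0 ≤ edgeWeight r i n x y := by
  by_cases h : IsWire i n x y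
  · exact mul_nonneg (mul_nonneg (hΛ n x y h).1.le (mass_nonneg _ _ _)) (mass_nonneg _ _ _)
  · exact (edgeWeight_of_not_isWire r h).ge

/-- On the support of the cutoff `|x - y| ≥ 1 / m`, which bounds the singular kernel by a constant
independent of `n`. -/
theorem cutoff_mul_edgeWeight_le (hi : 1 ≤ i) (hs : 0 < s) (hΛ0 : 0 < Λ)
    (hΛ : UpperKernelBound r i s Λ) (m n : ℕ) (x y : nodes i n) :
    cutoff m x y * edgeWeight r i n x y ≤
      Λ * (m : ℝ) ^ (1 + 2 * s) * (mass i n x * mass i n y) := by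
  have hmm : 0 ≤ mass i n x * mass i n y := mul_nonneg (mass_nonneg _ _ _) (mass_nonneg _ _ _)
  have hR : 0 ≤ Λ * (m : ℝ) ^ (1 + 2 * s) * (mass i n x * mass i n y) := by positivity
  by_cases hc : cutoff m x y = 0
  · rw [hc, zero_mul]; exact hR
  by_cases hw : IsWire i n x y
  · have h1 := one_le_of_cutoff_ne_zero hc
    have hm : (0 : ℝ) < m := by
      rcases Nat.eq_zero_or_pos m with rfl | h
      · norm_num at h1
      · exact_mod_cast h
    have h2 : (m : ℝ)⁻¹ ≤ |(x : ℝ) - y| := by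
      rw [inv_eq_one_div, div_le_iff₀' hm]; exact h1
    have h3 : |(x : ℝ) - y| ^ (-(1 + 2 * s)) ≤ (m : ℝ) ^ (1 + 2 * s) := by
      have := Real.rpow_le_rpow_of_nonpos (inv_pos.2 hm) h2 (by linarith : -(1 + 2 * s) ≤ 0)
      rwa [Real.inv_rpow hm.le, Real.rpow_neg hm.le, inv_inv] at this
    have h4 := cutoff_le_one (m := m) (physicalSpace_subset hi (node_mem_physicalSpace hi x.2))
      (physicalSpace_subset hi (node_mem_physicalSpace hi y.2))
    calc _ ≤ 1 * edgeWeight r i n x y :=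
          mul_le_mul_of_nonneg_right h4 (edgeWeight_nonneg hΛ _ _ _)
      _ = jumpKernel r i n x y * (mass i n x * mass i n y) := by rw [edgeWeight]; ring
      _ ≤ _ := mul_le_mul_of_nonneg_right
          ((hΛ n x y hw).2.trans (mul_le_mul_of_nonneg_left h3 hΛ0.le)) hmm
  · rw [edgeWeight_of_not_isWire r hw, mul_zero]; exact hR

theorem physicalMeasure_univ_le (hi : 1 ≤ i) : physicalMeasure i Set.univ ≤ 1 := by
  rw [physicalMeasure, Measure.restrict_apply_univ]
  calc _ ≤ volume (Set.Icc (0 : ℝ) 1) := measure_mono (physicalSpace_subset hi)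
    _ = 1 := by simp

theorem sum_mass_le_one (hi : 1 ≤ i) (n : ℕ) : ∑ x : nodes i n, mass i n x ≤ 1 := by
  have h := lintegral_physicalMeasure_eq_sum hi n (fun _ => 1)
  simp only [lintegral_const, one_mul, Measure.restrict_apply_univ] at h
  simp only [fun x : nodes i n => physicalMeasure_cell hi x.2] at h
  rw [← ENNReal.ofReal_sum_of_nonneg fun x _ => mass_nonneg _ _ _] at h
  have h1 := physicalMeasure_univ_le hi
  rw [h] at h1
  simpa using h1

/-- The vector of weighted differences whose squared norm is the truncated energy. -/
noncomputable def differenceVector (r : ℕ → ℕ → ℝ) (i m n : ℕ) (u : nodes i n → ℝ) :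
    EuclideanSpace ℝ (nodes i n × nodes i n) :=
  WithLp.toLp 2 fun p => √(cutoff m p.1 p.2 * edgeWeight r i n p.1 p.2) * (u p.1 - u p.2)

theorem differenceVector_sub (m n : ℕ) (u v : nodes i n → ℝ) :
    differenceVector r i m n (fun x => u x - v x) =
      differenceVector r i m n u - differenceVector r i m n v := by
  ext p
  simp only [differenceVector, PiLp.sub_apply]
  ring

theorem norm_differenceVector_sq (hΛ : UpperKernelBound r i s Λ) (m n : ℕ)
    (u : nodes i n → ℝ) : ‖differenceVector r i m n u‖ ^ 2 = truncatedEnergy r i m n u := by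
  rw [EuclideanSpace.norm_sq_eq, Fintype.sum_prod_type, truncatedEnergy]
  refine Finset.sum_congr rfl fun x _ => Finset.sum_congr rfl fun y _ => ?_
  simp only [differenceVector, Real.norm_eq_abs, sq_abs]
  rw [mul_pow, Real.sq_sqrt (mul_nonneg (cutoff_nonneg _ _ _) (edgeWeight_nonneg hΛ _ _ _))]
  ring

/-- The bound is uniform in `n`. The factor 4 comes from `(a - b) ^ 2 ≤ 2 * (a ^ 2 + b ^ 2)`, summed
over both variables with total mass at most 1. -/
theorem norm_differenceVector_le (hi : 1 ≤ i) (hs : 0 < s) (hΛ0 : 0 < Λ)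
    (hΛ : UpperKernelBound r i s Λ) (m n : ℕ) (u : nodes i n → ℝ) :
    ‖differenceVector r i m n u‖ ≤ √(4 * (Λ * (m : ℝ) ^ (1 + 2 * s))) * levelNorm i n u := by
  rw [levelNorm, ← Real.sqrt_mul (by positivity)]
  refine Real.le_sqrt_of_sq_le ?_
  rw [norm_differenceVector_sq hΛ, truncatedEnergy]
  set C := Λ * (m : ℝ) ^ (1 + 2 * s) with hC
  have hC0 : 0 ≤ C := by positivity
  set A := ∑ x : nodes i n, u x ^ 2 * mass i n x with hA
  set B := ∑ x : nodes i n, mass i n x with hB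
  have hA0 : 0 ≤ A := Finset.sum_nonneg fun x _ => mul_nonneg (sq_nonneg _) (mass_nonneg _ _ _)
  calc _ ≤ ∑ x : nodes i n, ∑ y : nodes i n,
        (2 * C * (u x ^ 2 * mass i n x * mass i n y) +
          2 * C * (mass i n x * (u y ^ 2 * mass i n y))) := by
        refine Finset.sum_le_sum fun x _ => Finset.sum_le_sum fun y _ => ?_
        have h1 := cutoff_mul_edgeWeight_le hi hs hΛ0 hΛ m n x y
        have h2 : (u x - u y) ^ 2 ≤ 2 * (u x ^ 2 + u y ^ 2) := by
          nlinarith [sq_nonneg (u x + u y)]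
        have h3 : 0 ≤ C * (mass i n x * mass i n y) :=
          mul_nonneg hC0 (mul_nonneg (mass_nonneg _ _ _) (mass_nonneg _ _ _))
        calc _ = (u x - u y) ^ 2 * (cutoff m x y * edgeWeight r i n x y) := by ring
          _ ≤ (u x - u y) ^ 2 * (C * (mass i n x * mass i n y)) := by gcongr
          _ ≤ 2 * (u x ^ 2 + u y ^ 2) * (C * (mass i n x * mass i n y)) := by gcongr
          _ = _ := by ring
    _ = 2 * C * (A * B) + 2 * C * (B * A) := by
        simp only [Finset.sum_add_distrib, ← Finset.mul_sum]
        rw [hA, hB, Finset.sum_mul_sum, Finset.sum_mul_sum]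
        simp only [Finset.mul_sum]
    _ = 4 * C * A * B := by ring
    _ ≤ 4 * C * A * 1 := by
        gcongr
        exact sum_mass_le_one hi n
    _ = _ := by ring

theorem ofReal_levelNorm_sub_le (hi : 1 ≤ i) {n : ℕ} {u v : ℝ → ℝ}
    (hu : AEStronglyMeasurable u (physicalMeasure i))
    (hv : AEStronglyMeasurable v (physicalMeasure i)) (w w' : nodes i n → ℝ) :
    ENNReal.ofReal (levelNorm i n fun x => w x - w' x) ≤
      eLpNorm (fun x => extend i n w x - u x) 2 (physicalMeasure i) +
        eLpNorm (u - v) 2 (physicalMeasure i) +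
        eLpNorm (fun x => extend i n w' x - v x) 2 (physicalMeasure i) := by
  rw [← eLpNorm_extend hi]
  have e : extend i n (fun x => w x - w' x) =
      ((fun x => extend i n w x - u x) + (u - v)) - (fun x => extend i n w' x - v x) := by
    funext z
    simp only [extend_sub, Pi.add_apply, Pi.sub_apply]
    ring
  rw [e]
  have m1 := (measurable_extend w).aestronglyMeasurable (μ := physicalMeasure i)
  have m2 := (measurable_extend w').aestronglyMeasurable (μ := physicalMeasure i)
  calc _ ≤ _ := eLpNorm_sub_le ((m1.sub hu).add (hu.sub hv)) (m2.sub hv) one_le_two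
    _ ≤ _ := add_le_add_left (eLpNorm_add_le (m1.sub hu) (hu.sub hv) one_le_two) _

/-- Functions on nodes are compared through their `L²` limits; the factor 3 counts two approximation
errors and the distance of the limits. -/
theorem eventually_levelNorm_sub_le (hi : 1 ≤ i) {u v : ℝ → ℝ}
    (hu : AEStronglyMeasurable u (physicalMeasure i))
    (hv : AEStronglyMeasurable v (physicalMeasure i)) {w w' : (n : ℕ) → nodes i n → ℝ}
    (hw : StronglyConverges i w u) (hw' : StronglyConverges i w' v) {ε : ℝ} (hε : 0 < ε)
    (huv : eLpNorm (u - v) 2 (physicalMeasure i) ≤ ENNReal.ofReal ε) :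
    ∀ᶠ n in atTop, levelNorm i n (fun x => w n x - w' n x) ≤ 3 * ε := by
  rw [StronglyConverges, ENNReal.tendsto_nhds_zero] at hw hw'
  have hε' : 0 < ENNReal.ofReal ε := by simpa using hε
  filter_upwards [hw _ hε', hw' _ hε'] with n h1 h2
  have h := (ofReal_levelNorm_sub_le hi hu hv (w n) (w' n)).trans
    (add_le_add (add_le_add h1 huv) h2)
  rw [← ENNReal.ofReal_add hε.le hε.le, ← ENNReal.ofReal_add (by positivity) hε.le,
    ENNReal.ofReal_le_ofReal_iff (by positivity)] at h
  linarith

/-- The truncated energies converge along every strongly convergent sequence, to a limit that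
depends on the limit function only. -/
theorem exists_tendsto_truncatedEnergy (hi : 1 ≤ i) (hs : 0 < s) (hΛ0 : 0 < Λ)
    (hΛ : UpperKernelBound r i s Λ)
    (hlim : ∀ f : ℝ → ℝ, IsLipschitz i f → ∃ L : ℝ, Tendsto (fun n =>
      discreteEnergy r i n (restrictNodes i n f)) atTop (𝓝 L))
    (m : ℕ) {u : ℝ → ℝ} (hu : MemLp u 2 (physicalMeasure i)) :
    ∃ L : ℝ, ∀ w : (n : ℕ) → nodes i n → ℝ, StronglyConverges i w u →
      Tendsto (fun n => truncatedEnergy r i m n (w n)) atTop (𝓝 L) := by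
  -- Adding 1 keeps `D` positive, so that one may divide by it even when `m = 0`.
  set D := √(4 * (Λ * (m : ℝ) ^ (1 + 2 * s))) + 1 with hD
  have hD0 : 0 < D := by positivity
  have hdiff : ∀ n (w w' : nodes i n → ℝ),
      |‖differenceVector r i m n w‖ - ‖differenceVector r i m n w'‖| ≤
        D * levelNorm i n (fun x => w x - w' x) := by
    intro n w w'
    refine (abs_norm_sub_norm_le _ _).trans ?_
    rw [← differenceVector_sub]
    refine (norm_differenceVector_le hi hs hΛ0 hΛ m n _).trans ?_
    exact mul_le_mul_of_nonneg_right (by linarith) (Real.sqrt_nonneg _)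
  have hav := stronglyConverges_average hi hu
  -- A Lipschitz `f` close to `u` has convergent truncated energies; by equicontinuity the norms for
  -- `u` eventually stay within `δ / 2` of that limit.
  have hcauchy : CauchySeq fun n => ‖differenceVector r i m n (average i n u)‖ := by
    rw [Metric.cauchySeq_iff']
    intro δ hδ
    set ε := δ / (12 * D) with hε
    have hε0 : 0 < ε := by positivity
    have hDε : D * (3 * ε) = δ / 4 := by rw [hε]; field_simp; norm_num
    obtain ⟨f, ⟨K, hK⟩, hf⟩ := exists_lipschitz_approx hu hε0
    have hfc : ContinuousOn f (physicalSpace i) := hK.continuous.continuousOn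
    obtain ⟨L, hL⟩ := tendsto_truncatedEnergy_restrictNodes hlim m
      (⟨K, hK.lipschitzOnWith⟩ : IsLipschitz i f)
    have hL' : Tendsto (fun n => ‖differenceVector r i m n (restrictNodes i n f)‖) atTop
        (𝓝 √L) := by
      refine hL.sqrt.congr fun n => ?_
      rw [← norm_differenceVector_sq hΛ, Real.sqrt_sq (norm_nonneg _)]
    have h1 := eventually_levelNorm_sub_le hi hu.1 (memLp_of_continuousOn hfc).1 hav
      (stronglyConverges_restrictNodes hi hfc) hε0 hf
    have h2 := (Metric.tendsto_atTop.1 hL') (δ / 4) (by positivity)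
    obtain ⟨N, hN⟩ := eventually_atTop.1 h1
    obtain ⟨N', hN'⟩ := h2
    have h3 : ∀ n ≥ max N N', |‖differenceVector r i m n (average i n u)‖ - √L| < δ / 2 := by
      intro n hn
      have a1 := (hdiff n (average i n u) (restrictNodes i n f)).trans
        (mul_le_mul_of_nonneg_left (hN n (le_of_max_le_left hn)) hD0.le)
      have a2 := hN' n (le_of_max_le_right hn)
      rw [Real.dist_eq] at a2
      rw [hDε] at a1
      calc _ ≤ _ := abs_sub_le _ ‖differenceVector r i m n (restrictNodes i n f)‖ _
        _ < δ / 2 := by linarith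
    refine ⟨max N N', fun n hn => ?_⟩
    rw [Real.dist_eq]
    have b1 := h3 n hn
    have b2 := h3 _ le_rfl
    rw [abs_sub_comm] at b2
    exact (abs_sub_le _ √L _).trans_lt (by linarith)
  obtain ⟨L, hL⟩ := cauchySeq_tendsto_of_complete hcauchy
  refine ⟨L ^ 2, fun w hw => ?_⟩
  have h1 : Tendsto (fun n => ‖differenceVector r i m n (w n)‖) atTop (𝓝 L) := by
    refine tendsto_of_tendsto_of_dist hL ?_
    rw [Metric.tendsto_atTop]
    intro δ hδ
    have hε0 : 0 < δ / (6 * D) := by positivity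
    -- Two sequences with the same strong limit `u` approach each other in level norm, so their
    -- truncated energies share a limit.
    have h1 := eventually_levelNorm_sub_le hi hu.1 hu.1 hav hw hε0 (by simp)
    obtain ⟨N, hN⟩ := eventually_atTop.1 h1
    refine ⟨N, fun n hn => ?_⟩
    rw [Real.dist_0_eq_abs, abs_of_nonneg dist_nonneg, Real.dist_eq]
    refine ((hdiff n _ _).trans (mul_le_mul_of_nonneg_left (hN n hn) hD0.le)).trans_lt ?_
    have : D * (3 * (δ / (6 * D))) = δ / 2 := by field_simp; norm_num
    rw [this]
    exact half_lt_self hδ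
  exact (h1.pow 2).congr fun n => norm_differenceVector_sq hΛ m n _

end

/-! ### Tails of the discrete energies -/

section

variable {r : ℕ → ℕ → ℝ} {i : ℕ} {s Λ : ℝ}

/-- The product measure on pairs of points of the physical space. -/
noncomputable def pairMeasure (i : ℕ) : Measure (ℝ × ℝ) :=
  (physicalMeasure i).prod (physicalMeasure i)

/-- Pairs of points at distance at most `10 / m`. -/
def nearDiagonal (m : ℕ) : Set (ℝ × ℝ) := {p | m * |p.1 - p.2| ≤ 10}

theorem measurableSet_nearDiagonal (m : ℕ) : MeasurableSet (nearDiagonal m) :=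
  measurableSet_le (by fun_prop) measurable_const

theorem pairMeasure_cell_prod (hi : 1 ≤ i) {n : ℕ} (x y : nodes i n) :
    pairMeasure i (cell i n x ×ˢ cell i n y) = ENNReal.ofReal (mass i n x * mass i n y) := by
  rw [pairMeasure, Measure.prod_prod, physicalMeasure_cell hi x.2, physicalMeasure_cell hi y.2,
    ENNReal.ofReal_mul (mass_nonneg _ _ _)]

/-- Each slice lies in an interval of length `20 / m`. -/
theorem tendsto_pairMeasure_nearDiagonal (hi : 1 ≤ i) :
    Tendsto (fun m => pairMeasure i (nearDiagonal m)) atTop (𝓝 0) := by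
  have h1 : Tendsto (fun m : ℕ => ENNReal.ofReal (20 / (m : ℝ))) atTop (𝓝 0) := by
    have := ENNReal.tendsto_ofReal (tendsto_const_div_atTop_nhds_zero_nat (20 : ℝ))
    rwa [ENNReal.ofReal_zero] at this
  refine tendsto_of_tendsto_of_tendsto_of_le_of_le' tendsto_const_nhds h1
    (.of_forall fun _ => zero_le) ?_
  filter_upwards [eventually_gt_atTop 0] with m hm
  have hm' : (0 : ℝ) < m := by exact_mod_cast hm
  rw [pairMeasure, Measure.prod_apply (measurableSet_nearDiagonal m)]
  calc _ ≤ ∫⁻ _, ENNReal.ofReal (20 / (m : ℝ)) ∂physicalMeasure i := by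
        refine lintegral_mono fun z => ?_
        refine (Measure.restrict_apply_le _ _).trans ?_
        have hsub : Prod.mk z ⁻¹' nearDiagonal m ⊆ Metric.closedBall z (10 / m) := by
          intro w hw
          have hw' : m * |z - w| ≤ 10 := hw
          rw [Metric.mem_closedBall, dist_comm, Real.dist_eq, le_div_iff₀ hm']
          linarith
        refine (measure_mono hsub).trans ?_
        rw [Real.volume_closedBall]
        exact le_of_eq (by ring_nf)
    _ ≤ ENNReal.ofReal (20 / (m : ℝ)) * 1 := by
        rw [lintegral_const]
        gcongr
        exact physicalMeasure_univ_le hi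
    _ = _ := mul_one _

theorem truncatedEnergy_le (hi : 1 ≤ i) (hΛ : UpperKernelBound r i s Λ) (m n : ℕ)
    (u : nodes i n → ℝ) : truncatedEnergy r i m n u ≤ discreteEnergy r i n u := by
  rw [discreteEnergy_eq, truncatedEnergy]
  refine Finset.sum_le_sum fun x _ => Finset.sum_le_sum fun y _ => ?_
  have h4 := cutoff_le_one (m := m) (physicalSpace_subset hi (node_mem_physicalSpace hi x.2))
    (physicalSpace_subset hi (node_mem_physicalSpace hi y.2))
  exact mul_le_of_le_one_left (mul_nonneg (sq_nonneg _) (edgeWeight_nonneg hΛ _ _ _)) h4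

/-- `G` dominates the energy of `u` on every pair of cells joined by a wire. -/
def Dominates (r : ℕ → ℕ → ℝ) (i n : ℕ) (G : ℝ × ℝ → ℝ≥0∞) (u : nodes i n → ℝ) : Prop :=
  ∀ x y : nodes i n, IsWire i n x y → ENNReal.ofReal ((u x - u y) ^ 2 * edgeWeight r i n x y) ≤
    ∫⁻ p in cell i n x ×ˢ cell i n y, G p ∂pairMeasure i

/-- A wire with `m * |x - y| ≥ 5` is counted in full by the truncated energy. For the others,
`IsWire.abs_sub_le` doubles 5 to 10, so their disjoint cell products lie in `nearDiagonal m`. -/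
theorem discreteEnergy_le_add (hi : 1 ≤ i) (hΛ : UpperKernelBound r i s Λ) (m n : ℕ)
    {G : ℝ × ℝ → ℝ≥0∞} {u : nodes i n → ℝ} (hG : Dominates r i n G u) :
    ENNReal.ofReal (discreteEnergy r i n u) ≤ ENNReal.ofReal (truncatedEnergy r i m n u) +
      ∫⁻ p in nearDiagonal m, G p ∂(pairMeasure i).restrict (linked i) := by
  classical
  set a : nodes i n × nodes i n → ℝ := fun p => (u p.1 - u p.2) ^ 2 * edgeWeight r i n p.1 p.2
    with ha
  have ha0 : ∀ p, 0 ≤ a p := fun p => mul_nonneg (sq_nonneg _) (edgeWeight_nonneg hΛ _ _ _)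
  set T : Finset (nodes i n × nodes i n) := Finset.univ.filter fun p =>
    IsWire i n p.1 p.2 ∧ m * |(p.1 : ℝ) - p.2| < 5 with hT
  have h1 : discreteEnergy r i n u ≤ truncatedEnergy r i m n u + ∑ p ∈ T, a p := by
    rw [discreteEnergy_eq, truncatedEnergy, ← Fintype.sum_prod_type' (fun x y : nodes i n =>
      (u x - u y) ^ 2 * edgeWeight r i n x y), ← Fintype.sum_prod_type' (fun x y : nodes i n =>
      cutoff m x y * ((u x - u y) ^ 2 * edgeWeight r i n x y)), hT, Finset.sum_filter,
      ← Finset.sum_add_distrib]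
    refine Finset.sum_le_sum fun p _ => ?_
    have hx := physicalSpace_subset hi (node_mem_physicalSpace hi p.1.2)
    have hy := physicalSpace_subset hi (node_mem_physicalSpace hi p.2.2)
    change a p ≤ cutoff m p.1 p.2 * a p + _
    split_ifs with h
    · have := mul_nonneg (cutoff_nonneg m p.1 p.2) (ha0 p)
      linarith
    · rw [add_zero]
      by_cases hw : IsWire i n p.1 p.2
      · have h5 : 5 ≤ m * |(p.1 : ℝ) - p.2| := by
          by_contra h5
          exact h ⟨hw, not_le.1 h5⟩
        rw [cutoff_eq_one hx hy h5, one_mul]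
      · have : a p = 0 := by simp only [ha, edgeWeight_of_not_isWire r hw, mul_zero]
        rw [this, mul_zero]
  have hdisj : (T : Set (nodes i n × nodes i n)).PairwiseDisjoint
      fun p => cell i n p.1 ×ˢ cell i n p.2 := by
    intro p _ q _ hpq
    simp only [Function.onFun, Set.disjoint_prod]
    by_cases h : (p.1 : ℝ) = q.1
    · right
      refine cell_disjoint hi p.2.2 q.2.2 fun h' => hpq ?_
      exact Prod.ext (Subtype.ext h) (Subtype.ext h')
    · exact .inl (cell_disjoint hi p.1.2 q.1.2 h)
  have h2 : ENNReal.ofReal (∑ p ∈ T, a p) ≤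
      ∫⁻ p in nearDiagonal m, G p ∂(pairMeasure i).restrict (linked i) := by
    rw [ENNReal.ofReal_sum_of_nonneg fun p _ => ha0 p,
      Measure.restrict_restrict (measurableSet_nearDiagonal m)]
    calc _ ≤ ∑ p ∈ T, ∫⁻ q in cell i n p.1 ×ˢ cell i n p.2, G q ∂pairMeasure i :=
          Finset.sum_le_sum fun p hp => hG p.1 p.2 (Finset.mem_filter.1 hp).2.1
      _ = ∫⁻ q in ⋃ p ∈ T, cell i n p.1 ×ˢ cell i n p.2, G q ∂pairMeasure i :=
          (lintegral_biUnion_finset hdisj (fun p _ =>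
            (measurableSet_cell i n p.1).prod (measurableSet_cell i n p.2)) _).symm
      _ ≤ _ := by
          refine lintegral_mono_set (Set.iUnion₂_subset fun p hp q hq => ?_)
          obtain ⟨hw, h5⟩ := (Finset.mem_filter.1 hp).2
          refine ⟨?_, hw.mem_linked hi hq.1 hq.2⟩
          have h6 := hw.abs_sub_le hi hq.1 hq.2
          have : (m : ℝ) * |q.1 - q.2| ≤ m * (2 * |(p.1 : ℝ) - p.2|) := by gcongr
          change m * |q.1 - q.2| ≤ 10
          linarith
  calc _ ≤ ENNReal.ofReal (truncatedEnergy r i m n u + ∑ p ∈ T, a p) :=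
        ENNReal.ofReal_le_ofReal h1
    _ ≤ _ := ENNReal.ofReal_add_le
    _ ≤ _ := by gcongr

theorem le_liminf_discreteEnergy (hi : 1 ≤ i) (hΛ : UpperKernelBound r i s Λ) {L : ℕ → ℝ}
    {w : (n : ℕ) → nodes i n → ℝ}
    (hL : ∀ m, Tendsto (fun n => truncatedEnergy r i m n (w n)) atTop (𝓝 (L m))) :
    ⨆ m, ENNReal.ofReal (L m) ≤
      liminf (fun n => ENNReal.ofReal (discreteEnergy r i n (w n))) atTop := by
  refine iSup_le fun m => ?_
  rw [← (ENNReal.tendsto_ofReal (hL m)).liminf_eq]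
  exact liminf_le_liminf (.of_forall fun n =>
    ENNReal.ofReal_le_ofReal (truncatedEnergy_le hi hΛ m n (w n)))

/-- If the energies are dominated by an integrable function then their limit is the supremum of
the limits of the truncated energies. -/
theorem tendsto_discreteEnergy_of_dominates (hi : 1 ≤ i) (hΛ : UpperKernelBound r i s Λ)
    {L : ℕ → ℝ} {w : (n : ℕ) → nodes i n → ℝ}
    (hL : ∀ m, Tendsto (fun n => truncatedEnergy r i m n (w n)) atTop (𝓝 (L m)))
    {G : ℝ × ℝ → ℝ≥0∞} (hG : ∀ n, Dominates r i n G (w n))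
    (hfin : ∫⁻ p in linked i, G p ∂pairMeasure i ≠ ∞) :
    Tendsto (fun n => ENNReal.ofReal (discreteEnergy r i n (w n))) atTop
      (𝓝 (⨆ m, ENNReal.ofReal (L m))) ∧ ⨆ m, ENNReal.ofReal (L m) < ∞ := by
  set τ : ℕ → ℝ≥0∞ := fun m =>
    ∫⁻ p in nearDiagonal m, G p ∂(pairMeasure i).restrict (linked i) with hτ
  -- Absolute continuity of the integral of the majorant over sets of vanishing measure.
  have hτ0 : Tendsto τ atTop (𝓝 0) := by
    refine tendsto_setLIntegral_zero hfin ?_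
    refine tendsto_of_tendsto_of_tendsto_of_le_of_le tendsto_const_nhds
      (tendsto_pairMeasure_nearDiagonal hi) (fun _ => zero_le) fun m => ?_
    exact Measure.restrict_apply_le _ _
  have hlow := le_liminf_discreteEnergy hi hΛ hL
  have hup : ∀ m, limsup (fun n => ENNReal.ofReal (discreteEnergy r i n (w n))) atTop ≤
      ENNReal.ofReal (L m) + τ m := by
    intro m
    have h := (ENNReal.tendsto_ofReal (hL m)).add_const (τ m)
    rw [← h.limsup_eq]
    exact limsup_le_limsup (.of_forall fun n => discreteEnergy_le_add hi hΛ m n (hG n))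
  have hle : liminf (fun n => ENNReal.ofReal (discreteEnergy r i n (w n))) atTop ≤
    limsup (fun n => ENNReal.ofReal (discreteEnergy r i n (w n))) atTop := liminf_le_limsup
  refine ⟨tendsto_of_le_liminf_of_limsup_le hlow ?_, ?_⟩
  · have h : Tendsto (fun m => (⨆ m, ENNReal.ofReal (L m)) + τ m) atTop
        (𝓝 ((⨆ m, ENNReal.ofReal (L m)) + 0)) := tendsto_const_nhds.add hτ0
    rw [add_zero] at h
    refine ge_of_tendsto' h fun m => (hup m).trans ?_
    gcongr
    exact le_iSup (fun m => ENNReal.ofReal (L m)) m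
  · refine (hlow.trans (hle.trans (hup 0))).trans_lt (ENNReal.add_lt_top.2 ⟨ENNReal.ofReal_lt_top, ?_⟩)
    exact (setLIntegral_le_lintegral _ _).trans_lt hfin.lt_top

/-! ### The Gagliardo density -/

/-- The integrand of the Gagliardo seminorm of order `s`. -/
noncomputable def gagliardo (s : ℝ) (u : ℝ → ℝ) (p : ℝ × ℝ) : ℝ≥0∞ :=
  ENNReal.ofReal ((u p.1 - u p.2) ^ 2) * ENNReal.ofReal |p.1 - p.2| ^ (-(1 + 2 * s))

theorem IsWire.ofReal_rpow_le (hi : 1 ≤ i) {n : ℕ} {x y : ℝ} (h : IsWire i n x y) {z w : ℝ}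
    (hz : z ∈ cell i n x) (hw : w ∈ cell i n y) {q : ℝ} (hq : 0 < q) :
    ENNReal.ofReal (|x - y| ^ (-q)) ≤ ENNReal.ofReal (2 ^ q) * ENNReal.ofReal |z - w| ^ (-q) := by
  have h2 : (0 : ℝ) < 2 ^ q := by positivity
  rcases (abs_nonneg (z - w)).eq_or_lt with h0 | h0
  -- On the diagonal the right-hand side is infinite, as `0 ^ (-q) = ∞` in `ℝ≥0∞`.
  · rw [← h0, ENNReal.ofReal_zero, ENNReal.zero_rpow_of_neg (by linarith), ENNReal.mul_top]
    · exact le_top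
    · simpa using h2
  · rw [ENNReal.ofReal_rpow_of_pos h0, ← ENNReal.ofReal_mul h2.le]
    refine ENNReal.ofReal_le_ofReal ?_
    have h1 := h.abs_sub_le hi hz hw
    calc |x - y| ^ (-q) ≤ (|z - w| / 2) ^ (-q) :=
          Real.rpow_le_rpow_of_nonpos (by positivity) (by linarith) (by linarith)
      _ = _ := by
          rw [Real.div_rpow h0.le (by norm_num), Real.rpow_neg (by norm_num : (0 : ℝ) ≤ 2),
            div_inv_eq_mul, mul_comm]

theorem IsWire.edgeWeight_le (hΛ : UpperKernelBound r i s Λ) {n : ℕ} {x y : ℝ}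
    (h : IsWire i n x y) :
    edgeWeight r i n x y ≤ Λ * |x - y| ^ (-(1 + 2 * s)) * (mass i n x * mass i n y) := by
  rw [edgeWeight, mul_assoc]
  exact mul_le_mul_of_nonneg_right (hΛ n x y h).2
    (mul_nonneg (mass_nonneg _ _ _) (mass_nonneg _ _ _))

/-- The difference of the two averages is the average of `u p.1 - u p.2` over the product of the
cells, to which Jensen's inequality applies. -/
theorem ofReal_average_sub_sq_le (hi : 1 ≤ i) {n : ℕ} {u : ℝ → ℝ}
    (hu : MemLp u 2 (physicalMeasure i)) (x y : nodes i n) :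
    ENNReal.ofReal ((average i n u x - average i n u y) ^ 2) *
        ENNReal.ofReal (mass i n x * mass i n y) ≤
      ∫⁻ p in cell i n x ×ˢ cell i n y, ENNReal.ofReal ((u p.1 - u p.2) ^ 2) ∂pairMeasure i := by
  set μ := (physicalMeasure i).restrict (cell i n x) with hμ
  set ν := (physicalMeasure i).restrict (cell i n y) with hν
  have e : (pairMeasure i).restrict (cell i n x ×ˢ cell i n y) = μ.prod ν := by
    rw [pairMeasure, hμ, hν, Measure.prod_restrict]
  have m1 : MemLp (fun p : ℝ × ℝ => u p.1) 2 (μ.prod ν) := (hu.restrict _).comp_fst ν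
  have m2 : MemLp (fun p : ℝ × ℝ => u p.2) 2 (μ.prod ν) := (hu.restrict _).comp_snd μ
  have h := ofReal_average_sq_mul_le (m1.sub m2)
  have hx := mass_pos hi x.2
  have hy := mass_pos hi y.2
  have r1 : μ.real Set.univ = mass i n x := by
    rw [measureReal_def, hμ, Measure.restrict_apply_univ, physicalMeasure_cell hi x.2,
      ENNReal.toReal_ofReal hx.le]
  have r2 : ν.real Set.univ = mass i n y := by
    rw [measureReal_def, hν, Measure.restrict_apply_univ, physicalMeasure_cell hi y.2,
      ENNReal.toReal_ofReal hy.le]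
  have r3 : (μ.prod ν).real Set.univ = mass i n x * mass i n y := by
    rw [← Set.univ_prod_univ, measureReal_prod_prod, r1, r2]
  have hav : ⨍ p, (u p.1 - u p.2) ∂(μ.prod ν) = average i n u x - average i n u y := by
    rw [average_eq_setAverage hi, average_eq_setAverage hi, MeasureTheory.average_eq,
      MeasureTheory.average_eq, MeasureTheory.average_eq,
      integral_sub (m1.integrable one_le_two) (m2.integrable one_le_two), integral_fun_fst,
      integral_fun_snd, r1, r2, r3]
    simp only [smul_eq_mul, ← hμ, ← hν]
    field_simp
  rw [e]
  have hm : ENNReal.ofReal (mass i n x * mass i n y) = (μ.prod ν) Set.univ := by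
    rw [← r3, ofReal_measureReal]
  rw [hm, ← hav]
  exact h

/-- The factor `2 ^ (1 + 2 * s)` is the price of replacing `|x - y|` in the kernel by the distance
of arbitrary points of the two cells. -/
theorem dominates_average (hi : 1 ≤ i) (hs : 0 < s) (hΛ0 : 0 < Λ)
    (hΛ : UpperKernelBound r i s Λ) (n : ℕ) {u : ℝ → ℝ} (hu : MemLp u 2 (physicalMeasure i)) :
    Dominates r i n (fun p => ENNReal.ofReal (Λ * 2 ^ (1 + 2 * s)) * gagliardo s u p)
      (average i n u) := by
  intro x y hw
  set A := (average i n u x - average i n u y) ^ 2 with hA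
  set c := Λ * |(x : ℝ) - y| ^ (-(1 + 2 * s)) with hc
  have hc0 : 0 ≤ c := by positivity
  calc _ ≤ ENNReal.ofReal (A * (c * (mass i n x * mass i n y))) :=
        ENNReal.ofReal_le_ofReal (mul_le_mul_of_nonneg_left (hw.edgeWeight_le hΛ) (sq_nonneg _))
    _ = ENNReal.ofReal c * (ENNReal.ofReal A * ENNReal.ofReal (mass i n x * mass i n y)) := by
        rw [← ENNReal.ofReal_mul (sq_nonneg _), ← ENNReal.ofReal_mul hc0]
        congr 1
        ring
    _ ≤ ENNReal.ofReal c * _ := by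
        gcongr
        exact ofReal_average_sub_sq_le hi hu x y
    _ = ∫⁻ p in cell i n x ×ˢ cell i n y,
        ENNReal.ofReal c * ENNReal.ofReal ((u p.1 - u p.2) ^ 2) ∂pairMeasure i :=
        (lintegral_const_mul' _ _ ENNReal.ofReal_ne_top).symm
    _ ≤ _ := by
        refine setLIntegral_mono' ((measurableSet_cell i n x).prod (measurableSet_cell i n y))
          fun p hp => ?_
        have h := hw.ofReal_rpow_le hi hp.1 hp.2 (q := 1 + 2 * s) (by linarith)
        rw [hc, ENNReal.ofReal_mul hΛ0.le, ENNReal.ofReal_mul hΛ0.le, gagliardo]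
        calc _ ≤ ENNReal.ofReal Λ * (ENNReal.ofReal (2 ^ (1 + 2 * s)) *
              ENNReal.ofReal |p.1 - p.2| ^ (-(1 + 2 * s))) *
              ENNReal.ofReal ((u p.1 - u p.2) ^ 2) := by gcongr
          _ = _ := by ring

/-- If the Gagliardo seminorm of the limit is infinite then the energies diverge along every
strongly convergent sequence. -/
theorem tendsto_discreteEnergy_top (hi : 1 ≤ i) (hΛ : UpperKernelBound r i s Λ) {l : ℝ}
    (hl0 : 0 < l) (hl : ∀ (n : ℕ) (x y : ℝ), IsWire i n x y →
      l * |x - y| ^ (-(1 + 2 * s)) ≤ jumpKernel r i n x y)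
    {u : ℝ → ℝ} (hu : MemLp u 2 (physicalMeasure i)) {w : (n : ℕ) → nodes i n → ℝ}
    (hw : StronglyConverges i w u)
    (htop : ∫⁻ p in linked i, gagliardo s u p ∂pairMeasure i = ∞) :
    Tendsto (fun n => ENNReal.ofReal (discreteEnergy r i n (w n))) atTop (𝓝 ∞) := by
  classical
  -- Strong convergence gives almost everywhere convergence only along subsequences, which suffices
  -- for divergence of the whole sequence.
  refine tendsto_of_subseq_tendsto fun ns hns => ?_
  have hmeas : TendstoInMeasure (physicalMeasure i)
      (fun k => extend i (ns k) (w (ns k))) atTop u :=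
    tendstoInMeasure_of_tendsto_eLpNorm two_ne_zero
      (fun k => (measurable_extend _).aestronglyMeasurable) hu.1 (hw.comp hns)
  obtain ⟨ms, hms, hae⟩ := hmeas.exists_seq_tendsto_ae
  refine ⟨ms, ?_⟩
  set N : ℕ → ℕ := fun k => ns (ms k) with hN
  have hNtop : Tendsto N atTop atTop := hns.comp hms.tendsto_atTop
  set a : (k : ℕ) → nodes i (N k) → nodes i (N k) → ℝ≥0∞ := fun k x y =>
    if IsWire i (N k) x y then ENNReal.ofReal
      (l * ((w (N k) x - w (N k) y) ^ 2 * |(x : ℝ) - y| ^ (-(1 + 2 * s)))) else 0 with ha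
  -- A step function whose integral bounds the energy from below by the lower kernel bound; Fatou's
  -- lemma is applied to it.
  set F : ℕ → ℝ × ℝ → ℝ≥0∞ := fun k p => ∑ x : nodes i (N k), ∑ y : nodes i (N k),
    (cell i (N k) x ×ˢ cell i (N k) y).indicator (fun _ => a k x y) p with hF
  have hcm : ∀ k (x y : nodes i (N k)), MeasurableSet (cell i (N k) x ×ˢ cell i (N k) y) :=
    fun k x y => (measurableSet_cell _ _ _).prod (measurableSet_cell _ _ _)
  have hFm : ∀ k, Measurable (F k) := fun k => Finset.measurable_fun_sum _ fun x _ =>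
    Finset.measurable_fun_sum _ fun y _ => measurable_const.indicator (hcm k x y)
  have hint : ∀ k, ∫⁻ p, F k p ∂pairMeasure i ≤
      ENNReal.ofReal (discreteEnergy r i (N k) (w (N k))) := by
    intro k
    have hnn : ∀ x y : nodes i (N k),
        0 ≤ (w (N k) x - w (N k) y) ^ 2 * edgeWeight r i (N k) x y := fun x y =>
      mul_nonneg (sq_nonneg _) (edgeWeight_nonneg hΛ _ _ _)
    rw [discreteEnergy_eq, ENNReal.ofReal_sum_of_nonneg fun x _ =>
      Finset.sum_nonneg fun y _ => hnn x y]
    simp only [hF]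
    rw [lintegral_finsetSum _ fun x _ => Finset.measurable_fun_sum _ fun y _ =>
      measurable_const.indicator (hcm k x y)]
    refine Finset.sum_le_sum fun x _ => ?_
    rw [ENNReal.ofReal_sum_of_nonneg fun y _ => hnn x y,
      lintegral_finsetSum _ fun y _ => measurable_const.indicator (hcm k x y)]
    refine Finset.sum_le_sum fun y _ => ?_
    rw [lintegral_indicator_const (hcm k x y), pairMeasure_cell_prod hi]
    simp only [ha]
    split_ifs with h
    · rw [← ENNReal.ofReal_mul (by positivity)]
      refine ENNReal.ofReal_le_ofReal ?_
      have hmm : 0 ≤ mass i (N k) x * mass i (N k) y :=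
        mul_nonneg (mass_nonneg _ _ _) (mass_nonneg _ _ _)
      calc _ = (w (N k) x - w (N k) y) ^ 2 * ((l * |(x : ℝ) - y| ^ (-(1 + 2 * s))) *
            (mass i (N k) x * mass i (N k) y)) := by ring
        _ ≤ (w (N k) x - w (N k) y) ^ 2 * (jumpKernel r i (N k) x y *
            (mass i (N k) x * mass i (N k) y)) := by
            gcongr
            exact hl _ _ _ h
        _ = _ := by rw [edgeWeight]; ring
    · simp
  have hpt : ∀ᵐ p ∂(pairMeasure i).restrict (linked i),
      ENNReal.ofReal l * gagliardo s u p ≤ liminf (fun k => F k p) atTop := by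
    have hgood := hae.and (ae_mem_cell hi)
    have g1 : ∀ᵐ p ∂pairMeasure i, _ := Measure.quasiMeasurePreserving_fst.ae hgood
    have g2 : ∀ᵐ p ∂pairMeasure i, _ := Measure.quasiMeasurePreserving_snd.ae hgood
    filter_upwards [ae_restrict_mem (measurableSet_linked i), ae_restrict_of_ae g1,
      ae_restrict_of_ae g2] with p hp h1 h2
    -- On the diagonal the Gagliardo density is `0 * ∞ = 0`.
    by_cases hne : p.1 = p.2
    · simp [gagliardo, hne]
    have hpos : 0 < |p.1 - p.2| := abs_pos.2 (sub_ne_zero.2 hne)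
    choose x hx hxc using h1.2
    choose y hy hyc using h2.2
    have hlimx : ∀ (q : ℝ) (t : ℕ → ℝ), (∀ n, q ∈ cell i n (t n)) →
        Tendsto (fun k => t (N k)) atTop (𝓝 q) := by
      intro q t ht
      refine tendsto_of_tendsto_of_dist tendsto_const_nhds
        (squeeze_zero (fun _ => dist_nonneg) (fun k => ?_)
          (tendsto_one_div_two_pow.comp hNtop))
      rw [Real.dist_eq]
      exact abs_sub_le_of_mem_cell hi (ht _)
    have hxl := hlimx _ x hxc
    have hyl := hlimx _ y hyc
    have hd : Tendsto (fun k => |x (N k) - y (N k)|) atTop (𝓝 |p.1 - p.2|) :=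
      (hxl.sub hyl).abs
    have hB : Tendsto (fun k => ENNReal.ofReal (l *
        ((extend i (N k) (w (N k)) p.1 - extend i (N k) (w (N k)) p.2) ^ 2 *
          |x (N k) - y (N k)| ^ (-(1 + 2 * s))))) atTop
        (𝓝 (ENNReal.ofReal (l * ((u p.1 - u p.2) ^ 2 * |p.1 - p.2| ^ (-(1 + 2 * s)))))) :=
      ENNReal.tendsto_ofReal ((((h1.1.sub h2.1).pow 2).mul
        (hd.rpow_const (.inl hpos.ne'))).const_mul l)
    have e : ENNReal.ofReal l * gagliardo s u p =
        ENNReal.ofReal (l * ((u p.1 - u p.2) ^ 2 * |p.1 - p.2| ^ (-(1 + 2 * s)))) := by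
      rw [gagliardo, ENNReal.ofReal_rpow_of_pos hpos, ← ENNReal.ofReal_mul (sq_nonneg _),
        ← ENNReal.ofReal_mul hl0.le]
    rw [e, ← hB.liminf_eq]
    refine liminf_le_liminf ?_
    -- Once the nodes of the cells containing `p.1` and `p.2` differ, linkedness makes them a wire,
    -- and `F k p` contains its term.
    filter_upwards [hd.eventually (lt_mem_nhds hpos)] with k hk
    have hxy : x (N k) ≠ y (N k) := fun h => by simp [h] at hk
    have hwire := isWire_of_mem_linked hi (hx _) (hy _) hxy (hxc (N k)) (hyc (N k)) hp
    set X : nodes i (N k) := ⟨x (N k), hx _⟩ with hX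
    set Y : nodes i (N k) := ⟨y (N k), hy _⟩ with hY
    have hmem : p ∈ cell i (N k) X ×ˢ cell i (N k) Y := ⟨hxc (N k), hyc (N k)⟩
    calc _ = a k X Y := by
          simp only [ha]
          rw [if_pos hwire, extend_eq hi (w (N k)) X (hxc _), extend_eq hi (w (N k)) Y (hyc _)]
      _ = (cell i (N k) X ×ˢ cell i (N k) Y).indicator (fun _ => a k X Y) p :=
          (Set.indicator_of_mem hmem (fun _ => a k X Y)).symm
      _ ≤ ∑ y' : nodes i (N k),
          (cell i (N k) X ×ˢ cell i (N k) y').indicator (fun _ => a k X y') p :=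
          Finset.single_le_sum (f := fun y' : nodes i (N k) =>
            (cell i (N k) X ×ˢ cell i (N k) y').indicator (fun _ => a k X y') p)
            (fun _ _ => zero_le) (Finset.mem_univ Y)
      _ ≤ F k p := Finset.single_le_sum (f := fun x' : nodes i (N k) => ∑ y' : nodes i (N k),
            (cell i (N k) x' ×ˢ cell i (N k) y').indicator (fun _ => a k x' y') p)
            (fun _ _ => zero_le) (Finset.mem_univ X)
  have hlim : liminf (fun k => ENNReal.ofReal (discreteEnergy r i (N k) (w (N k)))) atTop = ∞ := by
    rw [eq_top_iff]
    calc (∞ : ℝ≥0∞) = ∫⁻ p in linked i, ENNReal.ofReal l * gagliardo s u p ∂pairMeasure i := by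
          rw [lintegral_const_mul' _ _ ENNReal.ofReal_ne_top, htop, ENNReal.mul_top]
          simpa using hl0
      _ ≤ ∫⁻ p in linked i, liminf (fun k => F k p) atTop ∂pairMeasure i :=
          lintegral_mono_ae hpt
      _ ≤ liminf (fun k => ∫⁻ p in linked i, F k p ∂pairMeasure i) atTop :=
          lintegral_liminf_le hFm
      _ ≤ _ := liminf_le_liminf (.of_forall fun k =>
          (setLIntegral_le_lintegral _ _).trans (hint k))
  exact tendsto_of_le_liminf_of_limsup_le hlim.ge le_top

end

/-! ### Regular functions -/

section

variable {r : ℕ → ℕ → ℝ} {i : ℕ} {s Λ : ℝ}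

theorem lintegral_rieszKernel_lt_top (hs1 : s < 1) :
    ∫⁻ t in Metric.ball (0 : ℝ) 2, ENNReal.ofReal |t| ^ (-s) < ∞ := by
  have h : IntegrableOn (fun t : ℝ => |t| ^ (-s)) (Metric.ball 0 2) volume := by
    refine integrableOn_ball_of_norm_le_rpow (C := 1) (α := s) (by simp) (by simpa using hs1) ?_ ?_
    · refine ae_of_all _ fun t => ?_
      rw [one_mul, Real.norm_of_nonneg (by positivity), Real.norm_eq_abs]
    · exact (by fun_prop : Measurable fun t : ℝ => |t| ^ (-s)).aestronglyMeasurable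
  refine lt_of_eq_of_lt (lintegral_congr_ae ?_) h.hasFiniteIntegral
  filter_upwards [ae_restrict_of_ae (Measure.ae_ne volume (0 : ℝ))] with t ht
  rw [ENNReal.ofReal_rpow_of_pos (abs_pos.2 ht), Real.enorm_of_nonneg (by positivity)]

/-- The substitution `t = c - z` sends the space into `[-1, 1]`, inside the ball of radius 2; the
bound no longer depends on `c`. -/
theorem lintegral_physicalMeasure_rieszKernel_le (hi : 1 ≤ i) {c : ℝ}
    (hc : c ∈ Set.Icc (0 : ℝ) 1) :
    ∫⁻ z, ENNReal.ofReal |c - z| ^ (-s) ∂physicalMeasure i ≤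
      ∫⁻ t in Metric.ball (0 : ℝ) 2, ENNReal.ofReal |t| ^ (-s) := by
  rw [physicalMeasure, ← lintegral_indicator (measurableSet_physicalSpace i),
    ← lintegral_indicator Metric.isOpen_ball.measurableSet,
    ← lintegral_sub_left_eq_self (μ := volume)
      ((Metric.ball 0 2).indicator fun t => ENNReal.ofReal |t| ^ (-s)) c]
  refine lintegral_mono fun z => ?_
  by_cases hz : z ∈ physicalSpace i
  · have hz' := physicalSpace_subset hi hz
    rw [Set.indicator_of_mem hz, Set.indicator_of_mem]
    rw [mem_ball_zero_iff, Real.norm_eq_abs, abs_lt]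
    constructor <;> linarith [hz'.1, hz'.2, hc.1, hc.2]
  · rw [Set.indicator_of_notMem hz]
    exact zero_le

theorem lintegral_pairMeasure_rieszKernel_lt_top (hi : 1 ≤ i) (hs1 : s < 1) :
    ∫⁻ p, ENNReal.ofReal |p.1 - p.2| ^ (-s) ∂pairMeasure i < ∞ := by
  rw [pairMeasure, lintegral_prod _ (by fun_prop)]
  set J := ∫⁻ t in Metric.ball (0 : ℝ) 2, ENNReal.ofReal |t| ^ (-s) with hJ
  calc _ ≤ ∫⁻ _, J ∂physicalMeasure i := by
        refine lintegral_mono_ae ?_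
        filter_upwards [ae_restrict_mem (measurableSet_physicalSpace i)] with z hz
        exact lintegral_physicalMeasure_rieszKernel_le hi (physicalSpace_subset hi hz)
    _ < ∞ := by
        rw [lintegral_const]
        exact ENNReal.mul_lt_top (lintegral_rieszKernel_lt_top hs1) (measure_lt_top _ _)

theorem lintegral_pairMeasure_prod_rieszKernel_lt_top (hi : 1 ≤ i) (hs1 : s < 1) {c : ℝ}
    (hc : c ∈ Set.Icc (0 : ℝ) 1) :
    ∫⁻ p, ENNReal.ofReal |c - p.1| ^ (-s) * ENNReal.ofReal |c - p.2| ^ (-s) ∂pairMeasure i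
      < ∞ := by
  have h := (lintegral_physicalMeasure_rieszKernel_le (s := s) hi hc).trans_lt
    (lintegral_rieszKernel_lt_top hs1)
  have hm : Measurable fun z : ℝ => ENNReal.ofReal |c - z| ^ (-s) := by fun_prop
  rw [pairMeasure, lintegral_prod_mul hm.aemeasurable hm.aemeasurable]
  exact ENNReal.mul_lt_top h h

theorem dominates_of_le (hi : 1 ≤ i) (hΛ0 : 0 < Λ) (hΛ : UpperKernelBound r i s Λ) {n : ℕ}
    {u : nodes i n → ℝ} {H : ℝ × ℝ → ℝ≥0∞}
    (hH : ∀ x y : nodes i n, IsWire i n x y → ∀ p ∈ cell i n x ×ˢ cell i n y,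
      ENNReal.ofReal ((u x - u y) ^ 2 * |(x : ℝ) - y| ^ (-(1 + 2 * s))) ≤ H p) :
    Dominates r i n (fun p => ENNReal.ofReal Λ * H p) u := by
  intro x y hw
  set c := (u x - u y) ^ 2 * |(x : ℝ) - y| ^ (-(1 + 2 * s)) with hc
  have hc0 : 0 ≤ c := by positivity
  calc _ ≤ ENNReal.ofReal (Λ * c * (mass i n x * mass i n y)) := by
        refine ENNReal.ofReal_le_ofReal ?_
        refine (mul_le_mul_of_nonneg_left (hw.edgeWeight_le hΛ) (sq_nonneg _)).trans (le_of_eq ?_)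
        rw [hc]; ring
    _ = ∫⁻ _ in cell i n x ×ˢ cell i n y, ENNReal.ofReal Λ * ENNReal.ofReal c ∂pairMeasure i := by
        rw [setLIntegral_const, pairMeasure_cell_prod hi, ENNReal.ofReal_mul (by positivity),
          ENNReal.ofReal_mul hΛ0.le]
    _ ≤ _ := by
        refine setLIntegral_mono' ((measurableSet_cell i n x).prod (measurableSet_cell i n y))
          fun p hp => ?_
        gcongr
        exact hH x y hw p hp

/-- The energies of a regular function are dominated by an integrable function. -/
theorem exists_dominates_restrictNodes (hi : 1 ≤ i) (hs0 : 0 < s) (hs1 : s < 1) (hΛ0 : 0 < Λ)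
    (hΛ : UpperKernelBound r i s Λ) {f : ℝ → ℝ} (hf : IsCore i f) :
    ∃ G : ℝ × ℝ → ℝ≥0∞, (∀ n, Dominates r i n G (restrictNodes i n f)) ∧
      ∫⁻ p in linked i, G p ∂pairMeasure i ≠ ∞ := by
  have key : ∀ H : ℝ × ℝ → ℝ≥0∞, (∀ (n : ℕ) (x y : nodes i n), IsWire i n x y →
      ∀ p ∈ cell i n x ×ˢ cell i n y,
        ENNReal.ofReal ((f x - f y) ^ 2 * |(x : ℝ) - y| ^ (-(1 + 2 * s))) ≤ H p) →
      ∫⁻ p, H p ∂pairMeasure i < ∞ →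
      ∃ G : ℝ × ℝ → ℝ≥0∞, (∀ n, Dominates r i n G (restrictNodes i n f)) ∧
        ∫⁻ p in linked i, G p ∂pairMeasure i ≠ ∞ := by
    intro H hH hfin
    refine ⟨fun p => ENNReal.ofReal Λ * H p, fun n => dominates_of_le hi hΛ0 hΛ (hH n), ?_⟩
    refine ((setLIntegral_le_lintegral _ _).trans_lt ?_).ne
    rw [lintegral_const_mul' _ _ ENNReal.ofReal_ne_top]
    exact ENNReal.mul_lt_top ENNReal.ofReal_lt_top hfin
  have hmem : ∀ {n : ℕ} (x : nodes i n), (x : ℝ) ∈ physicalSpace i :=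
    fun x => node_mem_physicalSpace hi x.2
  have hle1 : ∀ {n : ℕ} (x y : nodes i n), |(x : ℝ) - y| ≤ 1 := fun x y => by
    have h1 := physicalSpace_subset hi (hmem x)
    have h2 := physicalSpace_subset hi (hmem y)
    rw [abs_le]
    constructor <;> linarith [h1.1, h1.2, h2.1, h2.2]
  unfold IsCore at hf
  split_ifs at hf with h1 h2
  · obtain ⟨K, hK⟩ := hf
    refine key (fun p => ENNReal.ofReal ((K : ℝ) ^ 2 * 2 ^ s) *
      ENNReal.ofReal |p.1 - p.2| ^ (-s)) ?_ ?_
    · intro n x y hw p hp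
      have hpos : 0 < |(x : ℝ) - y| := abs_pos.2 (sub_ne_zero.2 (hw.ne hi))
      have hd := hK.dist_le_mul x (hmem x) y (hmem y)
      rw [Real.dist_eq, Real.dist_eq] at hd
      have h3 : (f x - f y) ^ 2 ≤ (K * |(x : ℝ) - y|) ^ 2 := by
        rw [← sq_abs (f x - f y)]
        gcongr
      have h4 : (f x - f y) ^ 2 * |(x : ℝ) - y| ^ (-(1 + 2 * s)) ≤
          (K : ℝ) ^ 2 * |(x : ℝ) - y| ^ (-s) := by
        calc _ ≤ (K * |(x : ℝ) - y|) ^ 2 * |(x : ℝ) - y| ^ (-(1 + 2 * s)) := by gcongr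
          _ = (K : ℝ) ^ 2 * |(x : ℝ) - y| ^ (2 + -(1 + 2 * s)) := by
              rw [Real.rpow_add hpos, Real.rpow_two]; ring
          -- The exponent `2 - (1 + 2 * s) = 1 - 2 * s` exceeds `-s` because `s < 1`, and `|x - y| ≤
          -- 1`; the weaker power `-s` is integrable.
          _ ≤ _ := by
              refine mul_le_mul_of_nonneg_left ?_ (by positivity)
              exact Real.rpow_le_rpow_of_exponent_ge hpos (hle1 x y) (by linarith)
      refine (ENNReal.ofReal_le_ofReal h4).trans ?_
      rw [ENNReal.ofReal_mul (by positivity), ENNReal.ofReal_mul (by positivity), mul_assoc]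
      gcongr
      exact hw.ofReal_rpow_le hi hp.1 hp.2 hs0
    · rw [lintegral_const_mul' _ _ ENNReal.ofReal_ne_top]
      exact ENNReal.mul_lt_top ENNReal.ofReal_lt_top
        (lintegral_pairMeasure_rieszKernel_lt_top hi hs1)
  · obtain ⟨C, hC⟩ := hf
    refine key (fun p => ENNReal.ofReal ((C : ℝ) ^ 2 * 2 ^ (2 * s)) *
      (ENNReal.ofReal |1 / 2 - p.1| ^ (-s) * ENNReal.ofReal |1 / 2 - p.2| ^ (-s))) ?_ ?_
    · intro n x y hw p hp
      have hpos : 0 < |(x : ℝ) - y| := abs_pos.2 (sub_ne_zero.2 (hw.ne hi))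
      have hd : |f x - f y| ≤ C * |(x : ℝ) - y| ^ (1 / 2 : ℝ) := by
        have h := hC x (hmem x) y (hmem y)
        rw [edist_dist, edist_dist, Real.dist_eq, Real.dist_eq, ENNReal.ofReal_rpow_of_pos hpos,
          ← ENNReal.ofReal_coe_nnreal, ← ENNReal.ofReal_mul (by positivity),
          ENNReal.ofReal_le_ofReal_iff (by positivity)] at h
        simpa using h
      have h3 : (f x - f y) ^ 2 ≤ (C : ℝ) ^ 2 * |(x : ℝ) - y| := by
        have h5 : (|(x : ℝ) - y| ^ (1 / 2 : ℝ)) ^ 2 = |(x : ℝ) - y| := by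
          rw [← Real.sqrt_eq_rpow, Real.sq_sqrt hpos.le]
        calc (f x - f y) ^ 2 = |f x - f y| ^ 2 := (sq_abs _).symm
          _ ≤ (C * |(x : ℝ) - y| ^ (1 / 2 : ℝ)) ^ 2 := by gcongr
          _ = _ := by rw [mul_pow, h5]
      have h4 : (f x - f y) ^ 2 * |(x : ℝ) - y| ^ (-(1 + 2 * s)) ≤
          (C : ℝ) ^ 2 * |(x : ℝ) - y| ^ (-(2 * s)) := by
        calc _ ≤ (C : ℝ) ^ 2 * |(x : ℝ) - y| * |(x : ℝ) - y| ^ (-(1 + 2 * s)) := by gcongr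
          _ = (C : ℝ) ^ 2 * |(x : ℝ) - y| ^ (1 + -(1 + 2 * s)) := by
              rw [Real.rpow_add hpos, Real.rpow_one]; ring
          _ = _ := by ring_nf
      refine (ENNReal.ofReal_le_ofReal h4).trans ?_
      rw [ENNReal.ofReal_mul (by positivity), ENNReal.ofReal_mul (by positivity), mul_assoc]
      gcongr
      refine (hw.ofReal_rpow_le hi hp.1 hp.2 (q := 2 * s) (by linarith)).trans ?_
      gcongr
      have hlink := hw.mem_linked hi hp.1 hp.2
      -- For `i = 2` linked points lie on opposite sides of `1 / 2`, so their distance is at least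
      -- each distance to `1 / 2`. This splits the singularity `-(2 * s)` into two factors of order
      -- `-s`, one in each variable.
      have h5 : |1 / 2 - p.1| * |1 / 2 - p.2| ≤ |p.1 - p.2| ^ 2 := by
        rw [linked, if_neg (by omega), h2] at hlink
        norm_num at hlink
        rw [← abs_mul, sq_abs, abs_le]
        rcases hlink with ⟨h6, h7⟩ | ⟨h6, h7⟩
        · constructor <;> nlinarith [mul_pos (sub_pos.2 h6) (sub_pos.2 h7)]
        · constructor <;> nlinarith [mul_pos (sub_pos.2 h6) (sub_pos.2 h7)]
      rw [← ENNReal.mul_rpow_of_ne_top ENNReal.ofReal_ne_top ENNReal.ofReal_ne_top,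
        ← ENNReal.ofReal_mul (abs_nonneg _),
        show -(2 * s) = (2 : ℕ) * (-s) by push_cast; ring, ENNReal.rpow_mul, ENNReal.rpow_natCast,
        ← ENNReal.ofReal_pow (abs_nonneg _), ENNReal.rpow_neg, ENNReal.rpow_neg]
      gcongr
    · rw [lintegral_const_mul' _ _ ENNReal.ofReal_ne_top]
      exact ENNReal.mul_lt_top ENNReal.ofReal_lt_top
        (lintegral_pairMeasure_prod_rieszKernel_lt_top hi hs1 (by norm_num))
  · have hi3 : 3 ≤ i := by omega
    obtain ⟨M, hM⟩ := (isCompact_physicalSpace i).exists_bound_of_continuousOn hf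
    have hi' : (3 : ℝ) ≤ i := by exact_mod_cast hi3
    -- For `i ≥ 3` the two ends are separated by a gap, so the kernel is bounded and boundedness of
    -- `f` is enough.
    have hgap : (0 : ℝ) < 1 - 2 / i := by
      rw [sub_pos, div_lt_one (by linarith)]
      linarith
    refine key (fun _ => ENNReal.ofReal ((2 * M) ^ 2 * (1 - 2 / (i : ℝ)) ^ (-(1 + 2 * s)))) ?_ ?_
    · intro n x y hw p hp
      refine ENNReal.ofReal_le_ofReal ?_
      have h3 : |f x - f y| ≤ 2 * M := by
        have a1 := hM x (hmem x)
        have a2 := hM y (hmem y)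
        rw [Real.norm_eq_abs] at a1 a2
        exact (abs_sub _ _).trans (by linarith)
      have h4 : 1 - 2 / (i : ℝ) ≤ |(x : ℝ) - y| := by
        have hlink := hw.mem_linked hi (self_mem_cell hi x.2) (self_mem_cell hi y.2)
        rw [linked, if_neg h1] at hlink
        have h5 : 2 / (i : ℝ) = 1 / i + 1 / i := by ring
        rcases hlink with ⟨h6, h7⟩ | ⟨h6, h7⟩ <;> simp only at h6 h7
        · exact le_abs.2 (.inr (by linarith))
        · exact le_abs.2 (.inl (by linarith))
      calc (f x - f y) ^ 2 * |(x : ℝ) - y| ^ (-(1 + 2 * s))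
          ≤ (2 * M) ^ 2 * |(x : ℝ) - y| ^ (-(1 + 2 * s)) := by
            rw [← sq_abs (f x - f y)]
            gcongr
        _ ≤ _ := by
            refine mul_le_mul_of_nonneg_left ?_ (by positivity)
            exact Real.rpow_le_rpow_of_nonpos hgap h4 (by linarith)
    · rw [lintegral_const, pairMeasure]
      exact ENNReal.mul_lt_top ENNReal.ofReal_lt_top (measure_lt_top _ _)

theorem IsCore.continuousOn {f : ℝ → ℝ} (hf : IsCore i f) : ContinuousOn f (physicalSpace i) := by
  unfold IsCore at hf
  split_ifs at hf
  · exact hf.choose_spec.continuousOn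
  · exact hf.choose_spec.continuousOn (by norm_num)
  · exact hf

end

end GraphDirected

/-! ### Assembly of the theorem. -/

open GraphDirected in
theorem mainTheorem2 (r : ℕ → ℕ → ℝ) (hr : GraphDirected.PositiveWeights r)
    (i : ℕ) (hi : 1 ≤ i) (s : ℝ) (hs0 : 0 < s) (hs1 : s < 1)
    (hker : GraphDirected.KernelBounds r i s)
    (hlim : ∀ f : ℝ → ℝ, (∃ K : ℝ≥0, LipschitzOnWith K f (GraphDirected.physicalSpace i)) →
      ∃ L : ℝ, Tendsto (fun n => GraphDirected.discreteEnergy r i n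
        (GraphDirected.restrictNodes i n f)) atTop (𝓝 L)) :
    (∀ u : ℝ → ℝ, MemLp u 2 (GraphDirected.physicalMeasure i) →
      Tendsto (fun n => ENNReal.ofReal (GraphDirected.discreteEnergy r i n
        (GraphDirected.average i n u))) atTop (𝓝 (GraphDirected.limitEnergy r i u))) ∧
    (∀ f : ℝ → ℝ, GraphDirected.IsCore i f →
      GraphDirected.limitEnergy r i f < ∞ ∧
      Tendsto (fun n => ENNReal.ofReal (GraphDirected.discreteEnergy r i n
        (GraphDirected.restrictNodes i n f))) atTop (𝓝 (GraphDirected.limitEnergy r i f))) ∧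
    GraphDirected.GammaConverges r i (GraphDirected.limitEnergy r i) := by
  obtain ⟨⟨Λ, hΛ0, hΛ⟩, l, hl0, hl⟩ := hker
  have htrunc : ∀ u : ℝ → ℝ, MemLp u 2 (physicalMeasure i) → ∃ L : ℕ → ℝ,
      ∀ m, ∀ w : (n : ℕ) → nodes i n → ℝ, StronglyConverges i w u →
        Tendsto (fun n => truncatedEnergy r i m n (w n)) atTop (𝓝 (L m)) := by
    intro u hu
    choose L hL using fun m => exists_tendsto_truncatedEnergy hi hs0 hΛ0 hΛ hlim m hu
    exact ⟨L, hL⟩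
  have hfinite : ∀ (u : ℝ → ℝ) (hu : MemLp u 2 (physicalMeasure i)) (L : ℕ → ℝ)
      (_ : ∀ m, ∀ w : (n : ℕ) → nodes i n → ℝ, StronglyConverges i w u →
        Tendsto (fun n => truncatedEnergy r i m n (w n)) atTop (𝓝 (L m))),
      ∫⁻ p in linked i, gagliardo s u p ∂pairMeasure i ≠ ∞ →
      Tendsto (fun n => ENNReal.ofReal (discreteEnergy r i n (average i n u))) atTop
        (𝓝 (⨆ m, ENNReal.ofReal (L m))) := by
    intro u hu L hL hfin
    refine (tendsto_discreteEnergy_of_dominates hi hΛ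
      (fun m => hL m _ (stronglyConverges_average hi hu))
      (fun n => dominates_average hi hs0 hΛ0 hΛ n hu) ?_).1
    rw [lintegral_const_mul' _ _ ENNReal.ofReal_ne_top]
    exact ENNReal.mul_ne_top ENNReal.ofReal_ne_top hfin
  have part1 : ∀ u : ℝ → ℝ, MemLp u 2 (physicalMeasure i) →
      Tendsto (fun n => ENNReal.ofReal (discreteEnergy r i n (average i n u))) atTop
        (𝓝 (limitEnergy r i u)) := by
    intro u hu
    -- As `limitEnergy` is a `limUnder`, it is enough that some limit exists.
    refine tendsto_nhds_limUnder ?_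
    by_cases hfin : ∫⁻ p in linked i, gagliardo s u p ∂pairMeasure i = ∞
    · exact ⟨∞, tendsto_discreteEnergy_top hi hΛ hl0 hl hu (stronglyConverges_average hi hu) hfin⟩
    · obtain ⟨L, hL⟩ := htrunc u hu
      exact ⟨_, hfinite u hu L hL hfin⟩
  refine ⟨part1, fun f hf => ?_, ?_, fun v hv => ?_⟩
  · have hmem := memLp_of_continuousOn hf.continuousOn
    have hstrong := stronglyConverges_restrictNodes hi hf.continuousOn
    obtain ⟨L, hL⟩ := htrunc f hmem
    obtain ⟨G, hG, hGfin⟩ := exists_dominates_restrictNodes hi hs0 hs1 hΛ0 hΛ hf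
    obtain ⟨hT, hlt⟩ := tendsto_discreteEnergy_of_dominates hi hΛ (fun m => hL m _ hstrong) hG hGfin
    -- An infinite Gagliardo integral would make the energies of the restrictions diverge, against
    -- their finite limit. Hence restrictions and averages both converge to the same supremum of
    -- truncated limits.
    have hfin : ∫⁻ p in linked i, gagliardo s f p ∂pairMeasure i ≠ ∞ := fun h =>
      hlt.ne (tendsto_nhds_unique hT (tendsto_discreteEnergy_top hi hΛ hl0 hl hmem hstrong h))
    have e := tendsto_nhds_unique (part1 f hmem) (hfinite f hmem L hL hfin)
    rw [e]
    exact ⟨hlt, hT⟩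
  · intro w v hv hw
    by_cases hfin : ∫⁻ p in linked i, gagliardo s v p ∂pairMeasure i = ∞
    · rw [(tendsto_discreteEnergy_top hi hΛ hl0 hl hv hw hfin).liminf_eq]
      exact le_top
    · obtain ⟨L, hL⟩ := htrunc v hv
      rw [tendsto_nhds_unique (part1 v hv) (hfinite v hv L hL hfin)]
      exact le_liminf_discreteEnergy hi hΛ fun m => hL m w hw
  · exact ⟨fun n => average i n v, stronglyConverges_average hi hv,
      (part1 v hv).limsup_eq.le⟩
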